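/- Let $\Sigma$ be an ordered alphabet and let $a<b$ be two of its letters. For a word $w=w[0]\cdots w[n-1]$ over $\Sigma$, the Burrows–Wheeler transform $\mathrm{BWT}(w)$ is the word obtained by sorting the $n$ rotations $w[i]\cdots w[n-1]\,w[0]\cdots w[i-1]$ ($0\le i<n$) of $w$ lexicographically (with multiplicity) and concatenating their last letters in this order; $r(w)$ denotes the number of maximal equal-letter runs of $\mathrm{BWT}(w)$. For an integer $k>5$ let $$w_k=\Big(\prod_{i=2}^{k-1} a b^i aa\cdot a b^i a b a^{i-2}\Big)\cdot a b^k a ,$$ where the product is concatenation in increasing order of $i$. Let $w_k^{\mathrm{ins}}=w_k a$ be obtained from $w_k$ by appending an $a$, let $w_k^{\mathrm{del}}$ be obtained by deleting the last letter of $w_k$ (which is an $a$), and let $w_k^{\mathrm{sub}}$ be obtained by replacing the last letter of $w_k$ by $b$; these are a single-letter insertion, deletion and substitution, respectively. Then for every $k>5$ $$r(w_k^{\mathrm{ins}})=r(w_k^{\mathrm{del}})=r(w_k^{\mathrm{sub}})=r(w_k)+(2k-8).$$ Moreover, the lengths $n=|w_k|$ are strictly increasing in $k>5$ (so the family $(w_k)_{k>5}$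 is infinite), and, as $k\to\infty$, $2k-8=\Theta(\sqrt n)$; that is, $$r(w_k^{\mathrm{ins}})-r(w_k)=\Theta(\sqrt n),\qquad r(w_k^{\mathrm{del}})-r(w_k)=\Theta(\sqrt n),\qquad r(w_k^{\mathrm{sub}})-r(w_k)=\Theta(\sqrt n).$$ -/

import Mathlib

open Asymptotics Filter

namespace BWT

variable {α : Type*} [LinearOrder α]

/-- The `i`-th conjugate (rotation) `w[i..n-1] w[0..i-1]` of a word `w` of length `n`. -/
def conj (w : List α) (i : ℕ) : List α := w.drop i ++ w.take i

/-- The conjugate array: the indices `0, …, n-1`, sorted by the lexicographic order of the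
corresponding conjugates, ties being broken by the index. -/
def conjArray (w : List α) : List ℕ :=
  (List.range w.length).mergeSort
    (fun i j => decide (conj w i < conj w j ∨ (conj w i = conj w j ∧ i ≤ j)))

/-- The Burrows-Wheeler transform `L` of `w`: `L[i] = w[n-1]` if `CA[i] = 0`, and
`L[i] = w[CA[i]-1]` otherwise. (All accesses are in range, so nothing is dropped.) -/
def bwt (w : List α) : List α :=
  (conjArray w).filterMap (fun j => if j = 0 then w[w.length - 1]? else w[j - 1]?)

/-- The number of maximal equal-letter runs of a word. -/
def runs (v : List α) : ℕ := (v.splitBy (fun x y => decide (x = y))).length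

/-- `r(w)`, the number of runs of the Burrows-Wheeler transform of `w`. -/
def r (w : List α) : ℕ := runs (bwt w)

/-- `w'` arises from `w` by inserting one character. -/
def IsInsertion (w w' : List α) : Prop :=
  ∃ (u v : List α) (c : α), w = u ++ v ∧ w' = u ++ [c] ++ v

/-- `w'` arises from `w` by deleting one character. -/
def IsDeletion (w w' : List α) : Prop :=
  ∃ (u v : List α) (c : α), w = u ++ [c] ++ v ∧ w' = u ++ v

/-- `w'` arises from `w` by replacing one character by a different one. -/
def IsSubstitution (w w' : List α) : Prop :=
  ∃ (u v : List α) (c d : α), c ≠ d ∧ w = u ++ [c] ++ v ∧ w' = u ++ [d] ++ v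

/-- `s_i = a b^i a a`. -/
def sWord (a b : α) (i : ℕ) : List α := [a] ++ List.replicate i b ++ [a, a]

/-- `e_i = a b^i a b a^(i-2)`, for `2 ≤ i`. -/
def eWord (a b : α) (i : ℕ) : List α :=
  [a] ++ List.replicate i b ++ [a, b] ++ List.replicate (i - 2) a

/-- `q_k = a b^k a`. -/
def qWord (a b : α) (k : ℕ) : List α := [a] ++ List.replicate k b ++ [a]

/-- `w_k = (s_2 e_2) (s_3 e_3) ⋯ (s_(k-1) e_(k-1)) q_k`; the list `List.range' 2 (k - 2)`
is `[2, 3, …, k-1]`. -/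
def wWord (a b : α) (k : ℕ) : List α :=
  (List.range' 2 (k - 2)).flatMap (fun i => sWord a b i ++ eWord a b i) ++ qWord a b k

end BWT

namespace BWT

/-! The BWT letters can be read off without sorting all conjugates. Take a list of finite words,
each branching off below the next, such that every conjugate extends a listed word, every listed
word is extended by some conjugate, and the listed word determines the letter cyclically preceding
the conjugate. The conjugates extending one listed word are then consecutive in sorted order and
contribute a constant block, so `r` is the number of letter changes along the list
(`changes_filterMap_eq`, `r_eq_changes_entries`).

Put k = m + 6. Up to rotation the four words differ only in two cyclic run lengths: the run a^x
across the junction of end and beginning, and the run b^K before it. The pairs (x, K) are (2, k) for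
w_k, (3, k) for the insertion, (1, k) for the deletion and (1, k + 1) for the substitution. `entries
x K m` is a suitable list for each pair, as shown by `isChain_entries`, `covered_of_isRun` and
`occurs_of_mem_entries`; `changes_entries` counts its changes.

The increase comes from the conjugates starting with exactly y letters b, for 2 ≤ y ≤ k - 2. Apart
from the one cut out of b^K, they give the letters a (b^y aaa b^y a), b (b^y aaa b^(y+1)), b (b^y ab
a^y), a (b^y ab a^(y-1) b). The remaining conjugate b^y a^x bb is preceded by b. For x = 2 it falls
between the two b's, and the group a b b b a costs two changes. For x = 3 it moves to the front (b a
b b a), for x = 1 to the back (a b b a b), and the group costs four. This gains 2(k - 3). Two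
changes are lost elsewhere: for x = 2 the conjugate starting with the whole junction run is preceded
by b but has neighbours preceded by a, whereas otherwise it joins a block of b's. The total is 2(k -
3) - 2 = 2k - 8. -/

/-! ### Runs along a sorted family of words -/

/-- The number of letter changes in a word that is read after the letter `c`;
the first letter counts as a change when `c = none`. -/
def changes {α : Type*} [DecidableEq α] : Option α → List α → ℕ
  | _, [] => 0
  | c, x :: l => (if c = some x then 0 else 1) + changes (some x) l

/-- The summand 1 is the group still open, with last letter `x`; the groups in `gs` are closed. -/
theorem length_splitBy_loop {α : Type*} [DecidableEq α] (l : List α) (x : α) (g : List α)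
    (gs : List (List α)) :
    (List.splitBy.loop (fun x y => decide (x = y)) l x g gs).length
      = gs.length + 1 + changes (some x) l := by
  induction l generalizing x g gs with
  | nil => simp [List.splitBy.loop, changes]
  | cons y l ih =>
    rw [List.splitBy.loop]
    by_cases h : x = y
    · simp [h, ih, changes]
    · simp [h, ih, changes]; omega

theorem runs_eq_changes {α : Type*} [LinearOrder α] (v : List α) : runs v = changes none v := by
  cases v with
  | nil => simp [runs, changes]
  | cons x l =>
    rw [runs, List.splitBy, length_splitBy_loop]
    simp only [changes, List.length_nil, reduceCtorEq, if_false]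

theorem changes_map {α β : Type*} [DecidableEq α] [DecidableEq β] {f : α → β}
    (hf : Function.Injective f) (c : Option α) (l : List α) :
    changes (c.map f) (l.map f) = changes c l := by
  induction l generalizing c with
  | nil => simp [changes]
  | cons x l ih =>
    have h := ih (some x)
    simp only [Option.map_some] at h
    cases c <;> simp [changes, h, hf.eq_iff]

/-- `u` branches off below `v`: every extension of `u` is less than every extension of `v`. -/
def BranchLT {α : Type*} [LinearOrder α] (u v : List α) : Prop :=
  ∀ s t : List α, u ++ s < v ++ t

theorem BranchLT.trans {α : Type*} [LinearOrder α] {u v w : List α}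
    (h : BranchLT u v) (h' : BranchLT v w) : BranchLT u w :=
  fun s t => lt_trans (h s []) (h' [] t)

theorem changes_filterMap_of_forall_eq {α ι : Type*} [DecidableEq α] (f : ι → Option α) (x : α)
    (l : List ι) (hl : ∀ i ∈ l, f i = some x) (l' : List ι) :
    changes (some x) ((l ++ l').filterMap f) = changes (some x) (l'.filterMap f) := by
  induction l with
  | nil => rfl
  | cons i l ih =>
    rw [List.cons_append, List.filterMap_cons_some (hl i (by simp)), changes,
      ih fun j hj => hl j (by simp [hj])]
    simp

/-- The runs of letters along a sorted family of words, read off from a branching list of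
prefixes, each of which determines the letter. -/
theorem changes_filterMap_eq {α ι : Type*} [LinearOrder α] (g : ι → List α) (f : ι → Option α)
    (ps : List (List α × α)) (hps : ps.Pairwise fun e e' => BranchLT e.1 e'.1)
    (l : List ι) (hl : l.Pairwise fun i j => g i ≤ g j)
    (hcov : ∀ i ∈ l, ∃ e ∈ ps, e.1 <+: g i ∧ f i = some e.2)
    (hocc : ∀ e ∈ ps, ∃ i ∈ l, e.1 <+: g i) (c : Option α) :
    changes c (l.filterMap f) = changes c (ps.map Prod.snd) := by
  induction ps generalizing l c with
  | nil =>
    cases l with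
    | nil => rfl
    | cons i l => simpa using hcov i (by simp)
  | cons e ps ih =>
    rw [List.pairwise_cons] at hps
    set q : ι → Bool := fun i => decide (e.1 <+: g i) with hq
    have hsplit := List.takeWhile_append_dropWhile (p := q) (l := l)
    -- The first index not extending `e` extends a later prefix, so it and everything after it lie
    -- above all extensions of `e`. Hence the extensions of `e` form an initial segment of `l`.
    have hlate : ∀ i ∈ l.dropWhile q, ¬ e.1 <+: g i := by
      rcases hd : l.dropWhile q with _ | ⟨j, l'⟩
      · simp
      have hj : ¬ e.1 <+: g j := by
        have := List.head_dropWhile_not q (l := l) (by rw [hd]; simp)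
        simp only [hd, List.head_cons] at this
        simpa [hq] using this
      have hjl : j ∈ l := hsplit ▸ List.mem_append_right _ (by rw [hd]; simp)
      obtain ⟨e', he', hpre, -⟩ := hcov j hjl
      have he'ps : e' ∈ ps := by
        rcases List.mem_cons.1 he' with rfl | h
        · exact absurd hpre hj
        · exact h
      intro i hi hei
      have hle : g j ≤ g i := by
        rcases List.mem_cons.1 hi with rfl | h
        · exact le_rfl
        · have := hl.sublist (List.dropWhile_sublist q)
          rw [hd, List.pairwise_cons] at this
          exact this.1 i h
      obtain ⟨s, hs⟩ := hei
      obtain ⟨t, ht⟩ := hpre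
      have := hps.1 e' he'ps s t
      rw [hs, ht] at this
      exact absurd this (not_lt.2 hle)
    have hearly : ∀ i ∈ l.takeWhile q, f i = some e.2 := by
      intro i hi
      have hei : e.1 <+: g i := by simpa [hq] using List.mem_takeWhile_imp hi
      obtain ⟨e', he', hpre, hf⟩ := hcov i ((List.takeWhile_sublist q).subset hi)
      rcases List.mem_cons.1 he' with rfl | h
      · exact hf
      · obtain ⟨s, hs⟩ := hei
        obtain ⟨t, ht⟩ := hpre
        have := hps.1 e' h s t
        rw [hs, ht] at this
        exact absurd this (lt_irrefl _)
    have hrest := ih hps.2 (l.dropWhile q) (hl.sublist (List.dropWhile_sublist q)) (by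
        intro i hi
        obtain ⟨e', he', hpre, hf⟩ := hcov i ((List.dropWhile_sublist q).subset hi)
        rcases List.mem_cons.1 he' with rfl | h
        · exact absurd hpre (hlate i hi)
        · exact ⟨e', h, hpre, hf⟩) (by
        intro e' he'
        obtain ⟨i, hi, hpre⟩ := hocc e' (by simp [he'])
        refine ⟨i, ?_, hpre⟩
        rw [← hsplit, List.mem_append] at hi
        rcases hi with hi | hi
        · have hei : e.1 <+: g i := by simpa [hq] using List.mem_takeWhile_imp hi
          obtain ⟨s, hs⟩ := hei
          obtain ⟨t, ht⟩ := hpre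
          have := hps.1 e' he' s t
          rw [hs, ht] at this
          exact absurd this (lt_irrefl _)
        · exact hi) (some e.2)
    -- The initial segment is nonempty because `e` occurs; without `hocc` the letter of `e` could be
    -- counted although it is absent.
    rcases ht : l.takeWhile q with _ | ⟨j, l'⟩
    · obtain ⟨i, hi, hpre⟩ := hocc e (by simp)
      rw [← hsplit, ht, List.nil_append] at hi
      exact absurd hpre (hlate i hi)
    · rw [ht] at hearly
      rw [← hsplit, ht, List.cons_append, List.filterMap_cons_some (hearly j (by simp)), changes,
        changes_filterMap_of_forall_eq f e.2 l' (fun i hi => hearly i (by simp [hi])), hrest]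
      simp [changes]

/-! ### The transform as last letters of sorted conjugates -/

theorem conj_eq_rotate {α : Type*} {w : List α} {i : ℕ} (hi : i ≤ w.length) :
    conj w i = w.rotate i := (List.rotate_eq_drop_append_take hi).symm

theorem getLast?_conj {α : Type*} {w : List α} {i : ℕ} (hi : i < w.length) :
    (conj w i).getLast? = if i = 0 then w[w.length - 1]? else w[i - 1]? := by
  unfold conj
  split_ifs with h
  · simp [h, List.getLast?_eq_getElem?]
  · rw [List.getLast?_append, List.getLast?_take]
    have : w[i - 1]? = some (w[i - 1]'(by omega)) := List.getElem?_eq_getElem _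
    simp [h, this]

theorem pairwise_conjArray {α : Type*} [LinearOrder α] (w : List α) :
    (conjArray w).Pairwise fun i j => conj w i ≤ conj w j := by
  have h := List.pairwise_mergeSort
    (le := fun i j => decide (conj w i < conj w j ∨ (conj w i = conj w j ∧ i ≤ j)))
    (by
      intro i j k hij hjk
      simp only [decide_eq_true_eq] at *
      rcases hij with h1 | ⟨h1, h1'⟩ <;> rcases hjk with h2 | ⟨h2, h2'⟩
      · exact Or.inl (lt_trans h1 h2)
      · exact Or.inl (h2 ▸ h1)
      · exact Or.inl (h1 ▸ h2)
      · exact Or.inr ⟨h1.trans h2, h1'.trans h2'⟩)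
    (by
      intro i j
      simp only [Bool.or_eq_true, decide_eq_true_eq]
      rcases lt_trichotomy (conj w i) (conj w j) with h | h | h
      · exact Or.inl (Or.inl h)
      · rcases le_total i j with h' | h'
        · exact Or.inl (Or.inr ⟨h, h'⟩)
        · exact Or.inr (Or.inr ⟨h.symm, h'⟩)
      · exact Or.inr (Or.inl h)) (List.range w.length)
  refine h.imp ?_
  intro i j hij
  simp only [decide_eq_true_eq] at hij
  rcases hij with h | h
  · exact h.le
  · exact h.1.le

/-- The number of runs of the Burrows-Wheeler transform of a word conjugate to `c`, read off from a
branching list of prefixes of the conjugates of `c`. -/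
theorem r_eq_changes {α : Type*} [LinearOrder α] {w c : List α} (hwc : w ~r c)
    (ps : List (List α × α)) (hps : ps.Pairwise fun e e' => BranchLT e.1 e'.1)
    (hcov : ∀ u t : List α, u ++ t = c → t ≠ [] →
      ∃ e ∈ ps, e.1 <+: t ++ u ∧ (t ++ u).getLast? = some e.2)
    (hocc : ∀ e ∈ ps, ∃ u t : List α, u ++ t = c ∧ t ≠ [] ∧ e.1 <+: t ++ u) :
    r w = changes none (ps.map Prod.snd) := by
  have hmem : ∀ i, i ∈ conjArray w ↔ i < w.length := by
    intro i; simp [conjArray]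
  have hrot : ∀ u t : List α, u ++ t = c → w ~r t ++ u := by
    intro u t h
    exact hwc.trans (h ▸ List.isRotated_append)
  rw [r, runs_eq_changes]
  have hb : bwt w = (conjArray w).filterMap fun j => (conj w j).getLast? := by
    refine List.filterMap_congr fun j hj => ?_
    rw [getLast?_conj ((hmem j).1 hj)]
  rw [hb]
  refine changes_filterMap_eq (conj w) _ ps hps _ (pairwise_conjArray w) ?_ ?_ none
  · intro i hi
    have hi := (hmem i).1 hi
    rw [conj_eq_rotate hi.le]
    have h1 : c ~r w.rotate i := hwc.symm.trans ⟨i, rfl⟩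
    obtain ⟨n, hn, h⟩ := List.isRotated_iff_mod.1 h1
    rw [← h]
    -- The rotation by the full length corresponds to an empty `t`; it is replaced by the trivial
    -- rotation.
    rcases hn.lt_or_eq with hn' | hn'
    · rw [List.rotate_eq_drop_append_take hn]
      exact hcov _ _ (List.take_append_drop n c) (by simpa using hn')
    · have := hcov [] c rfl (by
        rw [← List.length_pos_iff, ← hwc.perm.length_eq]; omega)
      rw [hn', List.rotate_length]
      simpa using this
  · intro e he
    obtain ⟨u, t, h, ht, hpre⟩ := hocc e he
    have h0 : 0 < w.length := by
      have := List.length_pos_iff.2 ht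
      rw [hwc.perm.length_eq, ← h, List.length_append]
      omega
    obtain ⟨n, hn, h'⟩ := List.isRotated_iff_mod.1 (hrot u t h)
    rcases hn.lt_or_eq with hn' | hn'
    · exact ⟨n, (hmem n).2 hn', by rwa [conj_eq_rotate hn, h']⟩
    · refine ⟨0, (hmem 0).2 h0, ?_⟩
      rw [conj_eq_rotate (Nat.zero_le _), List.rotate_zero]
      rw [hn', List.rotate_length] at h'
      rwa [h']

/-! ### Run-length encoding and comparison of encoded words -/

/-- The two letters `a` and `b`, indexed by `false` and `true`. -/
def letter {α : Type*} (a b : α) (s : Bool) : α := if s then b else a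

/-- The word over `a` and `b` with the given run lengths, the first run being of `letter a b s`. -/
def decode {α : Type*} (a b : α) : Bool → List ℕ → List α
  | _, [] => []
  | s, n :: l => List.replicate n (letter a b s) ++ decode a b (!s) l

theorem letter_injective {α : Type*} {a b : α} (hab : a ≠ b) :
    Function.Injective (letter a b) := by
  intro s t h
  cases s <;> cases t <;> simp_all [letter, eq_comm]

theorem decode_append {α : Type*} (a b : α) (s : Bool) (l l' : List ℕ) :
    decode a b s (l ++ l') = decode a b s l ++ decode a b (not^[l.length] s) l' := by
  induction l generalizing s with
  | nil => rfl
  | cons n l ih => simp [decode, ih]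

theorem iterate_not_of_even {n : ℕ} (hn : Even n) (s : Bool) : not^[n] s = s := by
  obtain ⟨m, rfl⟩ := hn
  induction m with
  | zero => rfl
  | succ m ih =>
    rw [show m + 1 + (m + 1) = (m + m) + 2 by omega, Function.iterate_add_apply]
    simpa using ih

theorem decode_append_of_even {α : Type*} (a b : α) (s : Bool) {l l' : List ℕ}
    (hl : Even l.length) : decode a b s (l ++ l') = decode a b s l ++ decode a b s l' := by
  rw [decode_append, iterate_not_of_even hl]

/-- The list `p` of run lengths is a prefix of `l`, where the last run may be cut short. -/
def RunPrefix : List ℕ → List ℕ → Prop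
  | [], _ => True
  | [m], n :: _ => m ≤ n
  | m :: m' :: p, n :: l => m = n ∧ RunPrefix (m' :: p) l
  | _ :: _, [] => False

theorem RunPrefix.decode_isPrefix {α : Type*} (a b : α) (s : Bool) {p l : List ℕ}
    (h : RunPrefix p l) : decode a b s p <+: decode a b s l := by
  induction p generalizing s l with
  | nil => exact List.nil_prefix
  | cons m p ih =>
    cases l with
    | nil => cases p <;> exact h.elim
    | cons n l =>
      cases p with
      | nil =>
        have h : m ≤ n := h
        obtain ⟨d, rfl⟩ := Nat.exists_eq_add_of_le h
        simp only [decode, List.append_nil, List.replicate_add, List.append_assoc]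
        exact List.prefix_append _ _
      | cons m' p =>
        obtain ⟨rfl, h⟩ : m = n ∧ RunPrefix (m' :: p) l := h
        rw [decode, decode]
        exact (List.prefix_append_right_inj _).2 (ih _ h)

/-- The first run length exists and is positive. -/
def HeadPos : List ℕ → Prop
  | [] => False
  | n :: _ => 0 < n

/-- Two run length encodings starting with the same letter branch, the first below the second. -/
def RunLT : Bool → List ℕ → List ℕ → Prop
  | s, m :: l, n :: l' => (m = n ∧ RunLT (!s) l l') ∨
      (if s then m < n ∧ HeadPos l else n < m ∧ HeadPos l')
  | _, _, _ => False

theorem HeadPos.exists_decode {α : Type*} (a b : α) (s : Bool) {l : List ℕ} (h : HeadPos l) :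
    ∃ u, decode a b s l = letter a b s :: u := by
  cases l with
  | nil => exact h.elim
  | cons n l =>
    obtain ⟨m, rfl⟩ := Nat.exists_eq_succ_of_ne_zero (Nat.pos_iff_ne_zero.1 h)
    exact ⟨_, by rw [decode, List.replicate_succ, List.cons_append]⟩

theorem BranchLT.append_left {α : Type*} [LinearOrder α] {u v : List α} (h : BranchLT u v)
    (w : List α) : BranchLT (w ++ u) (w ++ v) := by
  intro s t
  have := h s t
  induction w with
  | nil => exact this
  | cons x w ih => exact List.cons_lt_cons_iff.2 (Or.inr ⟨rfl, ih⟩)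

theorem branchLT_cons {α : Type*} [LinearOrder α] {a b : α} (hab : a < b) (u v : List α) :
    BranchLT (a :: u) (b :: v) :=
  fun _ _ => List.cons_lt_cons_iff.2 (Or.inl hab)

/-- At the first differing run the shorter one is followed by the other letter while the longer one
continues. A shorter run of b's is therefore smaller, a shorter run of a's larger. `HeadPos` is
needed only after the shorter run, to make that next letter part of the prefix. -/
theorem RunLT.branchLT {α : Type*} [LinearOrder α] {a b : α} (hab : a < b) {s : Bool}
    {l l' : List ℕ} (h : RunLT s l l') : BranchLT (decode a b s l) (decode a b s l') := by
  induction l generalizing s l' with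
  | nil => cases l' <;> exact h.elim
  | cons m l ih =>
    cases l' with
    | nil => exact h.elim
    | cons n l' =>
      rcases (h : (m = n ∧ RunLT (!s) l l') ∨
        (if s then m < n ∧ HeadPos l else n < m ∧ HeadPos l')) with ⟨rfl, h⟩ | h
      · exact (ih h).append_left _
      · cases s with
        | true =>
          obtain ⟨hmn, hl⟩ : m < n ∧ HeadPos l := by simpa using h
          obtain ⟨d, rfl⟩ := Nat.exists_eq_add_of_lt hmn
          obtain ⟨u, hu⟩ := hl.exists_decode a b false
          simp only [decode, Bool.not_true, hu, Nat.add_assoc, List.replicate_add m,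
            List.replicate_succ, List.append_assoc, List.cons_append]
          exact (branchLT_cons hab _ _).append_left _
        | false =>
          obtain ⟨hmn, hl⟩ : n < m ∧ HeadPos l' := by simpa using h
          obtain ⟨d, rfl⟩ := Nat.exists_eq_add_of_lt hmn
          obtain ⟨u, hu⟩ := hl.exists_decode a b true
          simp only [decode, Bool.not_false, hu, Nat.add_assoc, List.replicate_add n,
            List.replicate_succ, List.append_assoc, List.cons_append]
          exact (branchLT_cons hab _ _).append_left _

/-- A prefix of conjugates, given by its first letter and its run lengths,
together with the letter that precedes it cyclically. -/
structure Entry where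
  fst : Bool
  lens : List ℕ
  prev : Bool

/-- The prefix `e` branches off below the prefix `e'`. -/
def Entry.LT (e e' : Entry) : Prop :=
  if e.fst = e'.fst then RunLT e.fst e.lens e'.lens
  else e.fst = false ∧ HeadPos e.lens ∧ HeadPos e'.lens

theorem Entry.LT.branchLT {α : Type*} [LinearOrder α] {a b : α} (hab : a < b) {e e' : Entry}
    (h : e.LT e') : BranchLT (decode a b e.fst e.lens) (decode a b e'.fst e'.lens) := by
  unfold Entry.LT at h
  split_ifs at h with hs
  · rw [← hs]
    exact h.branchLT hab
  · obtain ⟨h1, h2, h3⟩ := h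
    have h4 : e'.fst = true := by
      rw [h1] at hs
      simpa using Ne.symm hs
    obtain ⟨u, hu⟩ := h2.exists_decode a b e.fst
    obtain ⟨v, hv⟩ := h3.exists_decode a b e'.fst
    rw [hu, hv, h1, h4]
    exact branchLT_cons hab u v

/-! ### Cyclic run sequences and their conjugates -/

/-- `n` is a run length of the cyclic sequence `R` that belongs to the letter indexed by `s`,
and `l` is the list of the run lengths following it cyclically. -/
def IsRun (R : List ℕ) (s : Bool) (n : ℕ) (l : List ℕ) : Prop :=
  ∃ R₁ R₂, R = R₁ ++ n :: R₂ ∧ l = R₂ ++ R₁ ∧ s = not^[R₁.length] false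

/-- Evenness matters at the wrap-around: the last run then belongs to b, so the first one, of a's,
has the opposite letter. -/
theorem IsRun.next {R : List ℕ} (hR : Even R.length) {s : Bool} {n m : ℕ} {l : List ℕ}
    (h : IsRun R s n (m :: l)) : IsRun R (!s) m (l ++ [n]) := by
  obtain ⟨R₁, R₂, rfl, hl, rfl⟩ := h
  cases R₂ with
  | nil =>
    rw [List.nil_append] at hl
    subst hl
    refine ⟨[], l ++ [n], by simp, by simp, ?_⟩
    rw [← Function.iterate_succ_apply' not]
    simpa using iterate_not_of_even hR false
  | cons x R₂ =>
    obtain ⟨rfl, rfl⟩ : m = x ∧ l = R₂ ++ R₁ := by simpa using hl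
    refine ⟨R₁ ++ [n], R₂, by simp, by simp, ?_⟩
    rw [List.length_append, List.length_singleton, Function.iterate_succ_apply']

theorem getLast?_decode {α : Type*} (a b : α) (s : Bool) (n : ℕ) (l : List ℕ)
    (hn : 0 < n) (hl : ∀ m ∈ l, 0 < m) :
    (decode a b s (n :: l)).getLast? = some (letter a b (not^[l.length] s)) := by
  induction l generalizing s n with
  | nil => simp [decode, List.getLast?_replicate, hn.ne']
  | cons m l ih =>
    rw [decode, List.getLast?_append, ih _ _ (hl m (by simp)) fun k hk => hl k (by simp [hk])]
    simp

theorem exists_run_of_append_eq_decode {α : Type*} (a b : α) (s : Bool) (R : List ℕ)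
    {u t : List α} (h : u ++ t = decode a b s R) (ht : t ≠ []) :
    ∃ R₁ n R₂ y, R = R₁ ++ n :: R₂ ∧ 1 ≤ y ∧ y ≤ n ∧
      t = decode a b (not^[R₁.length] s) (y :: R₂) ∧
      u = decode a b s R₁ ++ List.replicate (n - y) (letter a b (not^[R₁.length] s)) := by
  induction R generalizing s u with
  | nil => simp [decode, ht] at h
  | cons n R ih =>
    rw [decode, List.append_eq_append_iff] at h
    rcases h with ⟨v, hv, htv⟩ | ⟨v, rfl, hv⟩
    -- A cut exactly between two runs is attributed to the following run, taken in full; this keeps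
    -- `1 ≤ y`.
    · by_cases hv0 : v = []
      · subst hv0
        rw [List.append_nil] at hv
        obtain ⟨R₁, n', R₂, y, rfl, hy, hyn, h1, h2⟩ :=
          ih (!s) (u := []) htv
        refine ⟨n :: R₁, n', R₂, y, rfl, hy, hyn, by simpa using h1, ?_⟩
        rw [← hv]
        have h3 := congrArg (List.replicate n (letter a b s) ++ ·) h2
        simpa [decode] using h3
      · have hv' := List.append_eq_replicate_iff.1 hv.symm
        have hpos := List.length_pos_iff.2 hv0
        refine ⟨[], n, R, v.length, rfl, hpos, by omega, ?_, ?_⟩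
        · rw [decode, htv]
          congr 1
          exact hv'.2.2
        · rw [show n - v.length = u.length by omega]
          simpa [decode] using hv'.2.1
    · obtain ⟨R₁, n', R₂, y, rfl, hy, hyn, h1, h2⟩ := ih (!s) hv.symm
      refine ⟨n :: R₁, n', R₂, y, rfl, hy, hyn, by simpa using h1, ?_⟩
      rw [h2]
      simp [decode]

/-- The number of runs of the Burrows-Wheeler transform, computed from run lengths. -/
theorem r_eq_changes_entries {α : Type*} [LinearOrder α] {a b : α} (hab : a < b) {w : List α}
    {R : List ℕ} (hw : w ~r decode a b false R) (hR : Even R.length) (hpos : ∀ n ∈ R, 0 < n)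
    (ps : List Entry) (hps : ps.IsChain Entry.LT)
    (hcov : ∀ s n l, IsRun R s n l → ∀ y, 1 ≤ y → y ≤ n →
      ∃ e ∈ ps, e.fst = s ∧ RunPrefix e.lens (y :: l) ∧ e.prev = if y < n then s else !s)
    (hocc : ∀ e ∈ ps, ∃ n l y, IsRun R e.fst n l ∧ 1 ≤ y ∧ y ≤ n ∧ RunPrefix e.lens (y :: l)) :
    r w = changes none (ps.map Entry.prev) := by
  -- The conjugate starts with the last `y` letters of a run and ends with the other `n - y`. By
  -- evenness the letters still alternate correctly where `R₂` is followed by `R₁`.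
  have hrw : ∀ R₁ n R₂ y, R = R₁ ++ n :: R₂ →
      decode a b (not^[R₁.length] false) (y :: R₂) ++ (decode a b false R₁ ++
        List.replicate (n - y) (letter a b (not^[R₁.length] false))) =
      decode a b (not^[R₁.length] false) (y :: (R₂ ++ R₁)) ++
        List.replicate (n - y) (letter a b (not^[R₁.length] false)) := by
    intro R₁ n R₂ y h
    rw [← List.cons_append, decode_append, List.append_assoc, ← Function.iterate_add_apply,
      iterate_not_of_even (n := (y :: R₂).length + R₁.length)]
    rw [h] at hR
    simpa [add_comm, add_left_comm] using hR
  rw [r_eq_changes hw (ps.map fun e => (decode a b e.fst e.lens, letter a b e.prev))]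
  · rw [List.map_map, ← changes_map (letter_injective hab.ne) none, List.map_map]
    rfl
  · have h1 : ps.IsChain fun e e' =>
        BranchLT (decode a b e.fst e.lens) (decode a b e'.fst e'.lens) :=
      hps.imp fun e e' h => h.branchLT hab
    have : Trans (fun e e' : Entry =>
          BranchLT (decode a b e.fst e.lens) (decode a b e'.fst e'.lens))
        (fun e e' : Entry => BranchLT (decode a b e.fst e.lens) (decode a b e'.fst e'.lens))
        (fun e e' : Entry => BranchLT (decode a b e.fst e.lens) (decode a b e'.fst e'.lens)) :=
      ⟨fun h h' => BranchLT.trans h h'⟩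
    exact List.pairwise_map.2 h1.pairwise
  · intro u t hut ht
    obtain ⟨R₁, n, R₂, y, hReq, hy, hyn, rfl, rfl⟩ :=
      exists_run_of_append_eq_decode a b false R hut ht
    obtain ⟨e, he, h1, h2, h3⟩ := hcov _ n (R₂ ++ R₁) ⟨R₁, R₂, hReq, rfl, rfl⟩ y hy hyn
    refine ⟨_, List.mem_map.2 ⟨e, he, rfl⟩, ?_, ?_⟩
    · rw [hrw _ _ _ _ hReq]
      simp only [h1]
      exact (h2.decode_isPrefix a b _).trans (List.prefix_append _ _)
    · rw [hrw _ _ _ _ hReq]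
      simp only [h3]
      -- If the run is cut, the preceding letter belongs to the same run; otherwise it ends the
      -- cyclically preceding run, which has the other letter.
      split_ifs with hlt
      · rw [List.getLast?_append, List.getLast?_replicate]
        simp [show n - y ≠ 0 by omega]
      · rw [show n - y = 0 by omega, List.replicate_zero, List.append_nil,
          getLast?_decode _ _ _ _ _ hy fun m hm => hpos m (by
            rw [hReq]; simp only [List.mem_append, List.mem_cons] at hm ⊢; tauto)]
        congr 2
        rw [← Bool.not_not (not^[(R₂ ++ R₁).length] _), ← Function.iterate_succ_apply' not,
          iterate_not_of_even]
        rw [hReq] at hR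
        simpa [add_comm, add_left_comm, add_assoc] using hR
  · intro e he
    obtain ⟨e, hep, rfl⟩ := List.mem_map.1 he
    obtain ⟨n, l, y, ⟨R₁, R₂, hReq, rfl, hs⟩, hy, hyn, hpre⟩ := hocc e hep
    refine ⟨decode a b false R₁ ++ List.replicate (n - y) (letter a b (not^[R₁.length] false)),
      decode a b e.fst (y :: R₂), ?_, ?_, ?_⟩
    · rw [hs, hReq, decode_append, decode, decode, List.append_assoc,
        ← List.append_assoc (List.replicate _ _), ← List.replicate_add,
        show n - y + y = n by omega]
    · intro h
      have := congrArg List.length h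
      simp [decode] at this
      omega
    · rw [hs, hrw _ _ _ _ hReq]
      exact (hpre.decode_isPrefix a b _).trans (List.prefix_append _ _)

theorem isRun_iff_rotate {R : List ℕ} {s : Bool} {n : ℕ} {l : List ℕ} :
    IsRun R s n l ↔ ∃ j < R.length, R.rotate j = n :: l ∧ s = not^[j] false := by
  constructor
  · rintro ⟨R₁, R₂, rfl, rfl, rfl⟩
    exact ⟨R₁.length, by simp, by rw [List.rotate_append_length_eq, List.cons_append], rfl⟩
  · rintro ⟨j, hj, hrot, rfl⟩
    rw [List.rotate_eq_drop_append_take hj.le, List.drop_eq_getElem_cons hj, List.cons_append,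
      List.cons.injEq] at hrot
    refine ⟨R.take j, R.drop (j + 1), ?_, hrot.2.symm, by rw [List.length_take_of_le hj.le]⟩
    rw [← hrot.1, ← List.drop_eq_getElem_cons hj, List.take_append_drop]

/-! ### Run lengths of the four words -/

/-- The run lengths of `s_i e_i`, rotated to begin with the run of `a`s that ends in `s_i`;
for `i = 2` this run has length `x`. -/
def blockRuns (x i : ℕ) : List ℕ := [if i = 2 then x else i - 2, i, 3, i, 1, 1]

/-- The run lengths of the cyclic words obtained from `w_(m+6)` by changing the length of its
last run of `b`s to `K` and that of the adjacent run of `a`s to `x`. -/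
def cycleRuns (x K m : ℕ) : List ℕ :=
  (List.range' 2 (m + 4)).flatMap (blockRuns x) ++ [m + 4, K]

theorem length_flatMap_blockRuns (x s n : ℕ) :
    ((List.range' s n).flatMap (blockRuns x)).length = 6 * n := by
  simp [List.length_flatMap, blockRuns, mul_comm]

theorem length_cycleRuns (x K m : ℕ) : (cycleRuns x K m).length = 6 * (m + 4) + 2 := by
  rw [cycleRuns, List.length_append, length_flatMap_blockRuns]
  rfl

theorem even_length_cycleRuns (x K m : ℕ) : Even (cycleRuns x K m).length := by
  rw [length_cycleRuns]
  exact ⟨3 * (m + 4) + 1, by ring⟩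

theorem pos_of_mem_cycleRuns {x K m n : ℕ} (hx : 0 < x) (hK : 0 < K)
    (hn : n ∈ cycleRuns x K m) : 0 < n := by
  simp only [cycleRuns, List.mem_append, List.mem_flatMap, List.mem_range'_1, blockRuns,
    List.mem_cons, List.not_mem_nil, or_false] at hn
  rcases hn with ⟨i, hi, hn⟩ | hn
  · split_ifs at hn <;> omega
  · omega

/-- The block number `d` belongs to i = d + 2. The window reaches into what follows, as far as any
prefix in the table needs. `p` absorbs the junction run at `d = 0`; `q` and `p'` absorb the last
block, which is followed by `K` and `x` instead of another block. -/
theorem cycleRuns_rotate_block (x K m d : ℕ) (hd : d < m + 4) :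
    ∃ p q p' N, (d = 0 ∧ p = x ∨ 1 ≤ d ∧ p = d) ∧
      (d < m + 3 ∧ q = d + 3 ∧ p' = 3 ∨ d = m + 3 ∧ q = K ∧ p' = x) ∧
      (cycleRuns x K m).rotate (6 * d) =
        p :: (d + 2) :: 3 :: (d + 2) :: 1 :: 1 :: (d + 1) :: q :: p' :: N := by
  have h1 : List.range' 2 (m + 4) = List.range' 2 d ++ List.range' (2 + d) (m + 4 - d) := by
    rw [List.range'_append_1]; congr 1; omega
  have h2 : (cycleRuns x K m).rotate (6 * d) =
      (List.range' (2 + d) (m + 4 - d)).flatMap (blockRuns x) ++ [m + 4, K] ++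
        (List.range' 2 d).flatMap (blockRuns x) := by
    rw [cycleRuns, h1, List.flatMap_append, List.append_assoc,
      ← length_flatMap_blockRuns x 2 d, List.rotate_append_length_eq]
  rw [h2, show m + 4 - d = (m + 3 - d) + 1 by omega, List.range'_succ, List.flatMap_cons]
  have hp : ∃ p, (d = 0 ∧ p = x ∨ 1 ≤ d ∧ p = d) ∧
      blockRuns x (2 + d) = [p, d + 2, 3, d + 2, 1, 1] := by
    refine ⟨if 2 + d = 2 then x else 2 + d - 2, ?_, by rw [blockRuns, add_comm 2 d]⟩
    split_ifs <;> omega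
  obtain ⟨p, hp, hb⟩ := hp
  rw [hb]
  rcases Nat.lt_or_ge d (m + 3) with hd' | hd'
  · rw [show m + 3 - d = (m + 2 - d) + 1 by omega, List.range'_succ, List.flatMap_cons, blockRuns,
      if_neg (by omega), show 2 + d + 1 - 2 = d + 1 by omega, show 2 + d + 1 = d + 3 by omega]
    exact ⟨p, _, _, _, hp, Or.inl ⟨hd', rfl, rfl⟩, rfl⟩
  · obtain rfl : d = m + 3 := by omega
    rw [Nat.sub_self, List.range'_succ (s := 2) (n := m + 2), List.flatMap_cons]
    exact ⟨p, _, _, _, hp, Or.inr ⟨rfl, rfl, rfl⟩, rfl⟩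

theorem cycleRuns_rotate_last (x K m : ℕ) :
    ∃ N, (cycleRuns x K m).rotate (6 * (m + 4)) = (m + 4) :: K :: x :: 2 :: 3 :: 2 :: 1 :: N := by
  rw [cycleRuns, ← length_flatMap_blockRuns x 2 (m + 4), List.rotate_append_length_eq,
    List.range'_succ (s := 2) (n := m + 3), List.flatMap_cons]
  exact ⟨_, rfl⟩

/-- The run at a given offset inside a block, together with the run lengths following it. -/
inductive RunShape (x K m : ℕ) : Bool → ℕ → List ℕ → Prop
  | a₁ (d p q p' : ℕ) (N : List ℕ) : d < m + 4 → (d = 0 ∧ p = x ∨ 1 ≤ d ∧ p = d) →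
      RunShape x K m false p ((d + 2) :: 3 :: (d + 2) :: 1 :: 1 :: (d + 1) :: q :: p' :: N)
  | b₁ (d q p' : ℕ) (N : List ℕ) : d < m + 4 →
      RunShape x K m true (d + 2) (3 :: (d + 2) :: 1 :: 1 :: (d + 1) :: q :: p' :: N)
  | a₂ (d q p' : ℕ) (N : List ℕ) : d < m + 4 →
      RunShape x K m false 3 ((d + 2) :: 1 :: 1 :: (d + 1) :: q :: p' :: N)
  | b₂ (d q p' : ℕ) (N : List ℕ) : d < m + 4 →
      (d < m + 3 ∧ q = d + 3 ∧ p' = 3 ∨ d = m + 3 ∧ q = K ∧ p' = x) →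
      RunShape x K m true (d + 2) (1 :: 1 :: (d + 1) :: q :: p' :: N)
  | a₃ (d : ℕ) (N : List ℕ) : d < m + 4 → RunShape x K m false 1 (1 :: (d + 1) :: N)
  | b₃ (d q p' : ℕ) (N : List ℕ) : d < m + 4 →
      (d < m + 3 ∧ q = d + 3 ∧ p' = 3 ∨ d = m + 3 ∧ q = K ∧ p' = x) →
      RunShape x K m true 1 ((d + 1) :: q :: p' :: N)
  | a₄ (N : List ℕ) : RunShape x K m false (m + 4) (K :: x :: 2 :: 3 :: N)
  | b₄ (N : List ℕ) : RunShape x K m true K (x :: 2 :: 3 :: N)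

/-- A run index is 6d + o. The quotient gives the block, with `d = m + 4` for the two closing runs,
and the parity of the offset `o` alone gives the letter. -/
theorem runShape_of_isRun {x K m : ℕ} {s : Bool} {n : ℕ} {l : List ℕ}
    (h : IsRun (cycleRuns x K m) s n l) : RunShape x K m s n l := by
  obtain ⟨j, hj, hrot, rfl⟩ := isRun_iff_rotate.1 h
  rw [length_cycleRuns] at hj
  obtain ⟨d, o, ho, rfl⟩ : ∃ d o, o < 6 ∧ j = 6 * d + o :=
    ⟨j / 6, j % 6, Nat.mod_lt _ (by norm_num), (Nat.div_add_mod j 6).symm⟩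
  rw [← List.rotate_rotate] at hrot
  have hpar : not^[6 * d + o] false = not^[o] false := by
    rw [add_comm, Function.iterate_add_apply, iterate_not_of_even (n := 6 * d) ⟨3 * d, by ring⟩]
  rw [hpar]
  rcases Nat.lt_or_ge d (m + 4) with hd | hd
  · obtain ⟨p, q, p', N, hp, hq, hN⟩ := cycleRuns_rotate_block x K m d hd
    rw [hN] at hrot
    interval_cases o <;>
      simp only [List.rotate_cons_succ, List.rotate_zero, List.cons_append, List.cons.injEq]
        at hrot <;>
      obtain ⟨rfl, rfl⟩ := hrot
    · exact .a₁ d _ _ _ _ hd hp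
    · exact .b₁ d _ _ _ hd
    · exact .a₂ d _ _ _ hd
    · exact .b₂ d _ _ _ hd hq
    · exact .a₃ d _ hd
    · exact .b₃ d _ _ _ hd hq
  · obtain rfl : d = m + 4 := by omega
    obtain ⟨N, hN⟩ := cycleRuns_rotate_last x K m
    rw [hN] at hrot
    obtain rfl | rfl : o = 0 ∨ o = 1 := by omega
    all_goals
      simp only [List.rotate_cons_succ, List.rotate_zero, List.cons_append, List.cons.injEq]
        at hrot
      obtain ⟨rfl, rfl⟩ := hrot
    · exact .a₄ _
    · exact .b₄ _

theorem exists_isRun_block (x K m d : ℕ) (hd : d < m + 4) :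
    ∃ p q p', (d = 0 ∧ p = x ∨ 1 ≤ d ∧ p = d) ∧
      (d < m + 3 ∧ q = d + 3 ∧ p' = 3 ∨ d = m + 3 ∧ q = K ∧ p' = x) ∧
      (∃ N, IsRun (cycleRuns x K m) false p
        ((d + 2) :: 3 :: (d + 2) :: 1 :: 1 :: (d + 1) :: q :: p' :: N)) ∧
      (∃ N, IsRun (cycleRuns x K m) true (d + 2)
        (3 :: (d + 2) :: 1 :: 1 :: (d + 1) :: q :: p' :: N)) ∧
      (∃ N, IsRun (cycleRuns x K m) false 3 ((d + 2) :: 1 :: 1 :: (d + 1) :: q :: p' :: N)) ∧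
      (∃ N, IsRun (cycleRuns x K m) true (d + 2) (1 :: 1 :: (d + 1) :: q :: p' :: N)) ∧
      (∃ N, IsRun (cycleRuns x K m) false 1 (1 :: (d + 1) :: q :: p' :: N)) ∧
      (∃ N, IsRun (cycleRuns x K m) true 1 ((d + 1) :: q :: p' :: N)) := by
  obtain ⟨p, q, p', N, hp, hq, hN⟩ := cycleRuns_rotate_block x K m d hd
  have hR := even_length_cycleRuns x K m
  have h1 : IsRun (cycleRuns x K m) false p
      ((d + 2) :: 3 :: (d + 2) :: 1 :: 1 :: (d + 1) :: q :: p' :: N) :=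
    isRun_iff_rotate.2 ⟨6 * d, by rw [length_cycleRuns]; omega, hN,
      (iterate_not_of_even ⟨3 * d, by ring⟩ false).symm⟩
  have h2 := h1.next hR
  have h3 := h2.next hR
  have h4 := h3.next hR
  have h5 := h4.next hR
  have h6 := h5.next hR
  exact ⟨p, q, p', hp, hq, ⟨_, h1⟩, ⟨_, h2⟩, ⟨_, h3⟩, ⟨_, h4⟩, ⟨_, h5⟩, ⟨_, h6⟩⟩

theorem exists_isRun_last (x K m : ℕ) :
    (∃ N, IsRun (cycleRuns x K m) false (m + 4) (K :: x :: 2 :: 3 :: N)) ∧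
      (∃ N, IsRun (cycleRuns x K m) true K (x :: 2 :: 3 :: N)) := by
  obtain ⟨N, hN⟩ := cycleRuns_rotate_last x K m
  have h1 : IsRun (cycleRuns x K m) false (m + 4) (K :: x :: 2 :: 3 :: 2 :: 1 :: N) :=
    isRun_iff_rotate.2 ⟨6 * (m + 4), by rw [length_cycleRuns]; omega, hN,
      (iterate_not_of_even ⟨3 * (m + 4), by ring⟩ false).symm⟩
  exact ⟨⟨_, h1⟩, ⟨_, h1.next (even_length_cycleRuns x K m)⟩⟩

/-! ### The table of branching prefixes -/

/-- Prefixes starting with at least four `a`s. -/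
def highEntries (m : ℕ) : List Entry :=
  ⟨false, [m + 4], true⟩ :: (List.range' 0 m).flatMap fun t =>
    [⟨false, [m + 3 - t, m + 5 - t, 1], true⟩, ⟨false, [m + 3 - t, m + 6 - t], false⟩]

/-- Prefixes starting with exactly three `a`s. -/
def midEntries (m : ℕ) : List Entry :=
  ⟨false, [3, 2, 1], true⟩ :: ⟨false, [3, 3, 1], true⟩ :: ⟨false, [3, 4, 1], true⟩ ::
    ⟨false, [3, 5, 1], true⟩ :: ((List.range' 6 m).flatMap (fun q =>
      [⟨false, [3, q, 2], false⟩, ⟨false, [3, q, 1, 1], true⟩]) ++ [⟨false, [3, m + 6], false⟩])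

/-- Prefixes starting with exactly one or two `a`s. -/
def lowEntries (x : ℕ) : List Entry :=
  (if x = 2 then [⟨false, [2, 2, 2], true⟩, ⟨false, [2, 2, 1, 1], false⟩]
    else [⟨false, [2, 2, 1], false⟩]) ++
  [⟨false, [2, 3, 1], false⟩, ⟨false, [2, 4, 2], true⟩, ⟨false, [2, 4, 1, 1], false⟩,
    ⟨false, [2, 5], false⟩, ⟨false, [1, 1, 1], true⟩] ++
  (if x = 1 then [⟨false, [1, 2, 2], true⟩, ⟨false, [1, 2, 1, 1], false⟩]
    else [⟨false, [1, 2, 1], false⟩]) ++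
  [⟨false, [1, 3, 2], true⟩, ⟨false, [1, 3, 1, 1], false⟩, ⟨false, [1, 4], false⟩]

/-- Prefixes starting with `baaa`. -/
def singleEntries (m : ℕ) : List Entry :=
  ⟨true, [1, 4], false⟩ :: ⟨true, [1, 3, 2, 1], true⟩ :: ⟨true, [1, 3, 3, 1], true⟩ ::
    ⟨true, [1, 3, 4, 1], true⟩ :: ⟨true, [1, 3, 5, 2], false⟩ :: ⟨true, [1, 3, 5, 1, 1], true⟩ ::
    (List.range' 6 m).flatMap fun q => [⟨true, [1, 3, q, 1], true⟩]

/-- Prefixes starting with `baab` or `bab`. -/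
def singleEntries' (x : ℕ) : List Entry :=
  (if x = 2 then [⟨true, [1, 2, 2, 1], true⟩, ⟨true, [1, 2, 3], false⟩]
    else [⟨true, [1, 2, 1], false⟩]) ++
  ⟨true, [1, 1, 1, 1], true⟩ :: (if x = 1 then [⟨true, [1, 1, 2, 1], true⟩, ⟨true, [1, 1, 3], false⟩]
    else [⟨true, [1, 1, 2], false⟩])

/-- Prefixes starting with exactly `y` letters `b`, for `2 ≤ y ≤ m + 4`. -/
def powerEntries (x y : ℕ) : List Entry :=
  (if x = 3 then [⟨true, [y, 3, 2, 2], true⟩, ⟨true, [y, 3, y, 1, 1], false⟩]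
    else [⟨true, [y, 3, y, 1], false⟩]) ++
  ⟨true, [y, 3, y + 1], true⟩ ::
  ((if x = 2 then [⟨true, [y, 2, 1], true⟩] else []) ++
  ⟨true, [y, 1, 1, y], true⟩ :: ⟨true, [y, 1, 1, y - 1, 1], false⟩ ::
  (if x = 1 then [⟨true, [y, 1, 2], true⟩] else []))

/-- Prefixes starting with at least `m + 5` letters `b`. -/
def lastEntries (x K m : ℕ) : List Entry :=
  (if x = 1 then [⟨true, [m + 5, 3], false⟩, ⟨true, [m + 5, 1, 1, 1], false⟩,
      ⟨true, [m + 5, 1, 2], true⟩]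
    else if x = 2 then [⟨true, [m + 5, 3], false⟩, ⟨true, [m + 5, 2, 1], true⟩,
      ⟨true, [m + 5, 1, 1], false⟩]
    else [⟨true, [m + 5, 3, 2, 2], true⟩, ⟨true, [m + 5, 3, m + 5], false⟩,
      ⟨true, [m + 5, 1, 1], false⟩]) ++
  (if K = m + 7 then [⟨true, [m + 6, 1], true⟩, ⟨true, [m + 7], false⟩]
    else [⟨true, [m + 6], false⟩])

/-- A branching list of prefixes of the conjugates of the word with run lengths
`cycleRuns x K m`. -/
def entries (x K m : ℕ) : List Entry :=
  highEntries m ++ (midEntries m ++ (lowEntries x ++ (singleEntries m ++ (singleEntries' x ++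
    ((List.range' 2 (m + 3)).flatMap (powerEntries x) ++ lastEntries x K m)))))

/-- The parameters of the four words. -/
def Admissible (x K m : ℕ) : Prop :=
  x = 2 ∧ K = m + 6 ∨ x = 3 ∧ K = m + 6 ∨ x = 1 ∧ K = m + 6 ∨ x = 1 ∧ K = m + 7

/-! ### Order of the table and number of letter changes -/

/-- A chain condition concerns neighbours only, so overlapping pieces suffice; `h0` serves the empty
range, and nonempty blocks provide the overlaps. -/
theorem isChain_append_flatMap_range' {β : Type*} {r : β → β → Prop} (f : ℕ → List β) (s n : ℕ)
    (hne : ∀ i, f i ≠ []) (l l' : List β) (x : β) (h0 : (l ++ [x]).IsChain r)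
    (h1 : 0 < n → (l ++ f s).IsChain r)
    (h2 : ∀ i, s ≤ i → i < s + n → (f i ++ [x]).IsChain r)
    (h3 : ∀ i, s ≤ i → i + 1 < s + n → (f i ++ f (i + 1)).IsChain r)
    (h4 : (x :: l').IsChain r) :
    (l ++ ((List.range' s n).flatMap f ++ x :: l')).IsChain r := by
  induction n generalizing s l with
  | zero =>
    have := h0.append_overlap (l₃ := l') (by simpa using h4) (by simp)
    simpa using this
  | succ n ih =>
    rw [List.range'_succ, List.flatMap_cons, List.append_assoc, ← List.append_assoc]
    exact (h1 (by omega)).append_overlap (ih (s + 1) (f s) (h2 s le_rfl (by omega))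
      (fun _ => h3 s le_rfl (by omega)) (fun i hi hi' => h2 i (by omega) (by omega))
      (fun i hi hi' => h3 i (by omega) (by omega))) (hne s)

theorem changes_nil {β : Type*} [DecidableEq β] (c : Option β) : changes c [] = 0 := rfl

theorem changes_cons {β : Type*} [DecidableEq β] (c : Option β) (x : β) (l : List β) :
    changes c (x :: l) = (if c = some x then 0 else 1) + changes (some x) l := rfl

theorem changes_flatMap_append {β : Type*} [DecidableEq β] (c : β) (B : List β) (t n s : ℕ)
    (l : List β) (h : ∀ l, changes (some c) (B ++ l) = t + changes (some c) l) :
    changes (some c) ((List.range' s n).flatMap (fun _ => B) ++ l) =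
      n * t + changes (some c) l := by
  induction n generalizing s with
  | zero => simp
  | succ n ih =>
    rw [List.range'_succ, List.flatMap_cons, List.append_assoc, h, ih]
    ring

/-- This variant serves blocks not ending in the letter before them: each block begins with `x` and
is followed by `x`, so the change at its end is charged to it. -/
theorem changes_flatMap_append_cons {β : Type*} [DecidableEq β] (c : Option β) (x : β) (B : List β)
    (t n s : ℕ) (l : List β)
    (h : ∀ c l, changes c (x :: B ++ x :: l) = t + changes c (x :: l)) :
    changes c ((List.range' s n).flatMap (fun _ => x :: B) ++ x :: l) =
      n * t + changes c (x :: l) := by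
  induction n generalizing s c with
  | zero => simp
  | succ n ih =>
    have h' : ∃ l', (List.range' (s + 1) n).flatMap (fun _ => x :: B) ++ x :: l = x :: l' := by
      cases n with
      | zero => exact ⟨l, rfl⟩
      | succ n => exact ⟨_, by rw [List.range'_succ, List.flatMap_cons]; rfl⟩
    obtain ⟨l', hl'⟩ := h'
    rw [List.range'_succ, List.flatMap_cons, List.append_assoc, hl', h, ← hl', ih]
    ring

theorem changes_entries {x K m : ℕ} (h : Admissible x K m) :
    changes none ((entries x K m).map Entry.prev) = if x = 2 then 6 * m + 24 else 8 * m + 28 := by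
  have e1 : ∀ l, changes (some true) ((List.range' 0 m).flatMap (fun _ => [true, false]) ++
      true :: l) = m * 2 + changes (some true) (true :: l) := fun l =>
    changes_flatMap_append_cons _ true [false] 2 m 0 l fun c l => by
      simp only [changes, List.cons_append, List.nil_append]; simp; omega
  have e2 : ∀ l, changes (some true) ((List.range' 6 m).flatMap (fun _ => [false, true]) ++ l) =
      m * 2 + changes (some true) l := fun l =>
    changes_flatMap_append true _ 2 m 6 l fun l => by simp [changes]; omega
  have e3 : ∀ l, changes (some true) ((List.range' 6 m).flatMap (fun _ => [true]) ++ l) =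
      m * 0 + changes (some true) l := fun l =>
    changes_flatMap_append true _ 0 m 6 l fun l => by simp [changes]
  have e4 : ∀ l, changes (some false) ((List.range' 2 (m + 3)).flatMap
      (fun _ => [false, true, true, true, false]) ++ l) = (m + 3) * 2 + changes (some false) l :=
    fun l => changes_flatMap_append false _ 2 (m + 3) 2 l fun l => by simp [changes]; omega
  have e5 : ∀ l, changes (some false) ((List.range' 2 (m + 3)).flatMap
      (fun _ => [true, false, true, true, false]) ++ l) = (m + 3) * 4 + changes (some false) l :=
    fun l => changes_flatMap_append false _ 4 (m + 3) 2 l fun l => by simp [changes]; omega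
  have e6 : ∀ l, changes (some false) ((List.range' 2 (m + 3)).flatMap
      (fun _ => [false, true, true, false, true]) ++ false :: l) =
        (m + 3) * 4 + changes (some false) (false :: l) := fun l =>
    changes_flatMap_append_cons _ false [true, true, false, true] 4 (m + 3) 2 l fun c l => by
      simp only [changes, List.cons_append, List.nil_append]; simp; omega
  have p1 : (highEntries m).map Entry.prev =
      true :: (List.range' 0 m).flatMap fun _ => [true, false] := by
    simp only [highEntries, List.map_cons, List.map_flatMap, List.map_nil]
  have p2 : (midEntries m).map Entry.prev = true :: true :: true :: true ::
      ((List.range' 6 m).flatMap (fun _ => [false, true]) ++ [false]) := by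
    simp only [midEntries, List.map_cons, List.map_append, List.map_flatMap, List.map_nil]
  have p3 : (singleEntries m).map Entry.prev = false :: true :: true :: true :: false :: true ::
      (List.range' 6 m).flatMap fun _ => [true] := by
    simp only [singleEntries, List.map_cons, List.map_flatMap, List.map_nil]
  rw [entries]
  simp only [List.map_append, p1, p2, p3, List.map_flatMap, List.cons_append, List.append_assoc,
    List.nil_append]
  generalize (List.range' 0 m).flatMap (fun _ => [true, false]) = L₁ at e1 ⊢
  generalize (List.range' 6 m).flatMap (fun _ => [false, true]) = L₂ at e2 ⊢
  generalize (List.range' 6 m).flatMap (fun _ => [true]) = L₃ at e3 ⊢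
  have d1 : (none = some true) = False := by simp
  have d2 : (some true = some false) = False := by simp
  have d3 : (some false = some true) = False := by simp
  have q1 : ((1 : ℕ) = 2) = False := by simp
  have q3 : ((3 : ℕ) = 2) = False := by simp
  rcases h with ⟨rfl, rfl⟩ | ⟨rfl, rfl⟩ | ⟨rfl, rfl⟩ | ⟨rfl, rfl⟩
  · have p4 : ∀ y, (powerEntries 2 y).map Entry.prev = [false, true, true, true, false] :=
      fun _ => rfl
    have p5 : (lastEntries 2 (m + 6) m).map Entry.prev = [false, true, false, false] := by
      simp [lastEntries]
    -- The leading `true` stands for the junction run aabbaa. It is isolated between entries with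
    -- `false` and costs the two changes absent for the other values of `x`.
    have p6 : (lowEntries 2).map Entry.prev = [true, false, false, true, false, false, true, false, true, false, false] := rfl
    have p7 : (singleEntries' 2).map Entry.prev = [true, false, true, false] := rfl
    simp only [p4, p5, p6, p7, changes_nil, changes_cons, e1, e2, e3, e4, List.cons_append, List.nil_append]
    simp only [d1, d2, d3, if_true, if_false]
    ring
  · have p4 : ∀ y, (powerEntries 3 y).map Entry.prev = [true, false, true, true, false] :=
      fun _ => rfl
    have p5 : (lastEntries 3 (m + 6) m).map Entry.prev = [true, false, false, false] := by
      simp [lastEntries]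
    have p6 : (lowEntries 3).map Entry.prev = [false, false, true, false, false, true, false, true, false, false] := rfl
    have p7 : (singleEntries' 3).map Entry.prev = [false, true, false] := rfl
    simp only [p4, p5, p6, p7, changes_nil, changes_cons, e1, e2, e3, e5, List.cons_append, List.nil_append]
    simp only [d1, d2, d3, if_true, if_false, q3]
    ring
  · have p4 : ∀ y, (powerEntries 1 y).map Entry.prev = [false, true, true, false, true] :=
      fun _ => rfl
    have p5 : (lastEntries 1 (m + 6) m).map Entry.prev = [false, false, true, false] := by
      simp [lastEntries]
    have p6 : (lowEntries 1).map Entry.prev = [false, false, true, false, false, true, true, false, true, false, false] := rfl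
    have p7 : (singleEntries' 1).map Entry.prev = [false, true, true, false] := rfl
    simp only [p4, p5, p6, p7, changes_nil, changes_cons, e1, e2, e3, e6, List.cons_append, List.nil_append]
    simp only [d1, d2, d3, if_true, if_false, q1]
    ring
  · have p4 : ∀ y, (powerEntries 1 y).map Entry.prev = [false, true, true, false, true] :=
      fun _ => rfl
    have p5 : (lastEntries 1 (m + 7) m).map Entry.prev = [false, false, true, true, false] := by
      simp [lastEntries]
    have p6 : (lowEntries 1).map Entry.prev = [false, false, true, false, false, true, true, false, true, false, false] := rfl
    have p7 : (singleEntries' 1).map Entry.prev = [false, true, true, false] := rfl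
    simp only [p4, p5, p6, p7, changes_nil, changes_cons, e1, e2, e3, e6, List.cons_append, List.nil_append]
    simp only [d1, d2, d3, if_true, if_false, q1]
    ring

theorem isChain_entries {x K m : ℕ} (h : Admissible x K m) :
    (entries x K m).IsChain Entry.LT := by
  have h1 : ∀ l, (midEntries m ++ l).IsChain Entry.LT →
      (highEntries m ++ (midEntries m ++ l)).IsChain Entry.LT := by
    intro l hl
    refine isChain_append_flatMap_range' _ 0 m (by simp) [_] _ _ ?_ ?_ ?_ ?_ hl
    · simp [Entry.LT, RunLT, HeadPos]
    · simp [Entry.LT, RunLT, HeadPos]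
    · simp [Entry.LT, RunLT, HeadPos]; omega
    · simp [Entry.LT, RunLT, HeadPos]; omega
  have h2 : ∀ l, (⟨false, [3, m + 6], false⟩ :: l : List Entry).IsChain Entry.LT →
      (midEntries m ++ l).IsChain Entry.LT := by
    intro l hl
    have := isChain_append_flatMap_range' (r := Entry.LT)
      (fun q => [⟨false, [3, q, 2], false⟩, ⟨false, [3, q, 1, 1], true⟩]) 6 m (by simp)
      [⟨false, [3, 2, 1], true⟩, ⟨false, [3, 3, 1], true⟩, ⟨false, [3, 4, 1], true⟩,
        ⟨false, [3, 5, 1], true⟩] l ⟨false, [3, m + 6], false⟩ ?_ ?_ ?_ ?_ hl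
    · simpa [midEntries] using this
    · simp [Entry.LT, RunLT, HeadPos]
    · simp [Entry.LT, RunLT, HeadPos]
    · simp [Entry.LT, RunLT, HeadPos]; omega
    · simp [Entry.LT, RunLT, HeadPos]
  -- Only the first entry of the next section matters; its start `1, 2, z` is common to all
  -- admissible `x`. The same device is used below with `m + 5, z`.
  have h3 : ∀ (z : ℕ) (p : List ℕ) (c : Bool) (l : List Entry), 0 < z →
      (⟨true, 1 :: 2 :: z :: p, c⟩ :: l : List Entry).IsChain Entry.LT →
      (singleEntries m ++ ⟨true, 1 :: 2 :: z :: p, c⟩ :: l : List Entry).IsChain Entry.LT := by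
    intro z p c l hz hl
    have := isChain_append_flatMap_range' (r := Entry.LT)
      (fun q => [⟨true, [1, 3, q, 1], true⟩]) 6 m (by simp)
      [⟨true, [1, 4], false⟩, ⟨true, [1, 3, 2, 1], true⟩, ⟨true, [1, 3, 3, 1], true⟩,
        ⟨true, [1, 3, 4, 1], true⟩, ⟨true, [1, 3, 5, 2], false⟩, ⟨true, [1, 3, 5, 1, 1], true⟩]
      l ⟨true, 1 :: 2 :: z :: p, c⟩ ?_ ?_ ?_ ?_ hl
    · simpa only [singleEntries, List.cons_append, List.nil_append] using this
    · simp [Entry.LT, RunLT, HeadPos, hz]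
    · simp [Entry.LT, RunLT, HeadPos]
    · simp [Entry.LT, RunLT, HeadPos, hz]
    · simp [Entry.LT, RunLT, HeadPos]
  have h4 : ∀ (z : ℕ) (p : List ℕ) (c : Bool) (l : List Entry), 0 < z →
      (⟨true, (m + 5) :: z :: p, c⟩ :: l : List Entry).IsChain Entry.LT →
      (singleEntries' x ++ ((List.range' 2 (m + 3)).flatMap (powerEntries x) ++
        ⟨true, (m + 5) :: z :: p, c⟩ :: l) : List Entry).IsChain Entry.LT := by
    intro z p c l hz hl
    refine isChain_append_flatMap_range' _ 2 (m + 3) (by simp [powerEntries]) _ _ _ ?_ ?_ ?_ ?_ hl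
    all_goals
      rcases h with ⟨rfl, rfl⟩ | ⟨rfl, rfl⟩ | ⟨rfl, rfl⟩ | ⟨rfl, rfl⟩ <;>
      simp [singleEntries', powerEntries, Entry.LT, RunLT, HeadPos] <;> omega
  refine h1 _ (h2 _ ?_)
  have h5 : ∀ l, (singleEntries m ++ l).IsChain Entry.LT → (⟨false, [3, m + 6], false⟩ ::
      (lowEntries x ++ (singleEntries m ++ l))).IsChain Entry.LT := by
    intro l hl
    have := List.IsChain.append_overlap (R := Entry.LT)
      (l₁ := ⟨false, [3, m + 6], false⟩ :: lowEntries x) (l₂ := [⟨true, [1, 4], false⟩]) ?_ hl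
      (by simp)
    · simpa [singleEntries] using this
    · rcases h with ⟨rfl, rfl⟩ | ⟨rfl, rfl⟩ | ⟨rfl, rfl⟩ | ⟨rfl, rfl⟩ <;>
      simp [lowEntries, Entry.LT, RunLT, HeadPos]
  refine h5 _ ?_
  have h6 : (lastEntries x K m).IsChain Entry.LT := by
    rcases h with ⟨rfl, rfl⟩ | ⟨rfl, rfl⟩ | ⟨rfl, rfl⟩ | ⟨rfl, rfl⟩ <;>
      simp [lastEntries, Entry.LT, RunLT, HeadPos]
  have h7 : (singleEntries' x ++ ((List.range' 2 (m + 3)).flatMap (powerEntries x) ++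
      lastEntries x K m)).IsChain Entry.LT := by
    obtain ⟨z, p, c, l, hz, hl⟩ : ∃ z p c l, 0 < z ∧
        lastEntries x K m = ⟨true, (m + 5) :: z :: p, c⟩ :: l := by
      rcases h with ⟨rfl, rfl⟩ | ⟨rfl, rfl⟩ | ⟨rfl, rfl⟩ | ⟨rfl, rfl⟩ <;>
        exact ⟨_, _, _, _, by norm_num, rfl⟩
    rw [hl] at h6 ⊢
    exact h4 z p c l hz h6
  obtain ⟨z, p, c, l, hz, hl⟩ : ∃ z p c l, 0 < z ∧
      singleEntries' x = ⟨true, 1 :: 2 :: z :: p, c⟩ :: l := by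
    rcases h with ⟨rfl, rfl⟩ | ⟨rfl, rfl⟩ | ⟨rfl, rfl⟩ | ⟨rfl, rfl⟩ <;>
      exact ⟨_, _, _, _, by norm_num, rfl⟩
  rw [hl] at h7 ⊢
  exact h3 z p c _ hz h7

/-! ### Membership in the table -/

theorem mem_entries {x K m : ℕ} {e : Entry} : e ∈ entries x K m ↔
    e ∈ highEntries m ∨ e ∈ midEntries m ∨ e ∈ lowEntries x ∨ e ∈ singleEntries m ∨
      e ∈ singleEntries' x ∨ (∃ y, 2 ≤ y ∧ y ≤ m + 4 ∧ e ∈ powerEntries x y) ∨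
      e ∈ lastEntries x K m := by
  simp only [entries, List.mem_append, List.mem_flatMap, List.mem_range'_1, and_assoc]
  constructor
  all_goals
    rintro (h | h | h | h | h | ⟨y, h1, h2, h⟩ | h)
    · exact Or.inl h
    · exact Or.inr (Or.inl h)
    · exact Or.inr (Or.inr (Or.inl h))
    · exact Or.inr (Or.inr (Or.inr (Or.inl h)))
    · exact Or.inr (Or.inr (Or.inr (Or.inr (Or.inl h))))
    · exact Or.inr (Or.inr (Or.inr (Or.inr (Or.inr (Or.inl ⟨y, h1, by omega, h⟩)))))
    · exact Or.inr (Or.inr (Or.inr (Or.inr (Or.inr (Or.inr h)))))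

/-- More leading a's means smaller, so the table runs through y = m + 3 - t downwards; here it is
reindexed by `y`. -/
theorem mem_highEntries {m : ℕ} {e : Entry} : e ∈ highEntries m ↔ e = ⟨false, [m + 4], true⟩ ∨
    ∃ y, 4 ≤ y ∧ y ≤ m + 3 ∧
      (e = ⟨false, [y, y + 2, 1], true⟩ ∨ e = ⟨false, [y, y + 3], false⟩) := by
  simp only [highEntries, List.mem_cons, List.mem_flatMap, List.mem_range'_1, List.not_mem_nil,
    or_false]
  refine or_congr_right ⟨?_, ?_⟩
  · rintro ⟨t, ht, h⟩
    refine ⟨m + 3 - t, by omega, by omega, ?_⟩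
    rwa [show m + 3 - t + 2 = m + 5 - t by omega, show m + 3 - t + 3 = m + 6 - t by omega]
  · rintro ⟨y, h4, hy, h⟩
    refine ⟨m + 3 - y, by omega, ?_⟩
    rwa [show m + 3 - (m + 3 - y) = y by omega, show m + 5 - (m + 3 - y) = y + 2 by omega,
      show m + 6 - (m + 3 - y) = y + 3 by omega]

theorem mem_midEntries {m : ℕ} {e : Entry} : e ∈ midEntries m ↔
    (∃ q, 2 ≤ q ∧ q ≤ 5 ∧ e = ⟨false, [3, q, 1], true⟩) ∨
    (∃ q, 6 ≤ q ∧ q ≤ m + 5 ∧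
      (e = ⟨false, [3, q, 2], false⟩ ∨ e = ⟨false, [3, q, 1, 1], true⟩)) ∨
    e = ⟨false, [3, m + 6], false⟩ := by
  have h : (∃ q, 2 ≤ q ∧ q ≤ 5 ∧ e = ⟨false, [3, q, 1], true⟩) ↔
      e = ⟨false, [3, 2, 1], true⟩ ∨ e = ⟨false, [3, 3, 1], true⟩ ∨ e = ⟨false, [3, 4, 1], true⟩ ∨
        e = ⟨false, [3, 5, 1], true⟩ := by
    constructor
    · rintro ⟨q, h2, h5, h⟩
      interval_cases q <;> simp [h]
    · rintro (h | h | h | h)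
      · exact ⟨2, by norm_num, by norm_num, h⟩
      · exact ⟨3, by norm_num, by norm_num, h⟩
      · exact ⟨4, by norm_num, by norm_num, h⟩
      · exact ⟨5, by norm_num, by norm_num, h⟩
  have h' : ∀ q, (6 ≤ q ∧ q < 6 + m) ↔ (6 ≤ q ∧ q ≤ m + 5) := fun q => by omega
  simp only [h, midEntries, List.mem_cons, List.mem_append, List.mem_flatMap, List.mem_range'_1,
    List.not_mem_nil, or_false, or_assoc, h', and_assoc]

/-- The value `q = 5` is exceptional: baaab^5 also arises at the end of the block i = 4, where it is
preceded by a, so a longer prefix is needed to fix the letter. -/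
theorem mem_singleEntries {m : ℕ} {e : Entry} : e ∈ singleEntries m ↔
    e = ⟨true, [1, 4], false⟩ ∨ (∃ q, 2 ≤ q ∧ q ≤ m + 5 ∧ q ≠ 5 ∧ e = ⟨true, [1, 3, q, 1], true⟩) ∨
    e = ⟨true, [1, 3, 5, 2], false⟩ ∨ e = ⟨true, [1, 3, 5, 1, 1], true⟩ := by
  have h : (∃ q, 2 ≤ q ∧ q ≤ m + 5 ∧ q ≠ 5 ∧ e = ⟨true, [1, 3, q, 1], true⟩) ↔
      e = ⟨true, [1, 3, 2, 1], true⟩ ∨ e = ⟨true, [1, 3, 3, 1], true⟩ ∨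
        e = ⟨true, [1, 3, 4, 1], true⟩ ∨
        ∃ q, (6 ≤ q ∧ q < 6 + m) ∧ e = ⟨true, [1, 3, q, 1], true⟩ := by
    constructor
    · rintro ⟨q, h2, hm, h5, h⟩
      rcases Nat.lt_or_ge q 6 with hq | hq
      · interval_cases q <;> simp_all
      · exact Or.inr (Or.inr (Or.inr ⟨q, by omega, h⟩))
    · rintro (h | h | h | ⟨q, hq, h⟩)
      · exact ⟨2, by omega, by omega, by omega, h⟩
      · exact ⟨3, by omega, by omega, by omega, h⟩
      · exact ⟨4, by omega, by omega, by omega, h⟩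
      · exact ⟨q, by omega, by omega, by omega, h⟩
  simp only [h, singleEntries, List.mem_cons, List.mem_flatMap, List.mem_range'_1,
    List.not_mem_nil, or_false]
  exact Iff.of_eq (by ac_rfl)

/-! ### Every conjugate extends a table entry with the right letter -/

/-- Some entry is a prefix of the conjugate starting `y` letters before the end of a run of length
`n` of letters indexed by `s`, and has the right preceding letter. -/
def Covered (x K m : ℕ) (s : Bool) (n : ℕ) (l : List ℕ) (y : ℕ) : Prop :=
  ∃ e ∈ entries x K m, e.fst = s ∧ RunPrefix e.lens (y :: l) ∧ e.prev = if y < n then s else !s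

theorem covered_of_lt {x K m : ℕ} {s : Bool} {n : ℕ} {l : List ℕ} {y : ℕ} (p : List ℕ)
    (hy : y < n) (hp : RunPrefix p (y :: l)) (he : ⟨s, p, s⟩ ∈ entries x K m) :
    Covered x K m s n l y :=
  ⟨_, he, rfl, hp, by rw [if_pos hy]⟩

theorem covered_self {x K m : ℕ} {s : Bool} {n : ℕ} {l : List ℕ} (p : List ℕ)
    (hp : RunPrefix p (n :: l)) (he : ⟨s, p, !s⟩ ∈ entries x K m) :
    Covered x K m s n l n :=
  ⟨_, he, rfl, hp, by rw [if_neg (lt_irrefl n)]⟩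

theorem mem_entries_low {x K m : ℕ} {e : Entry} (h : e ∈ lowEntries x) : e ∈ entries x K m :=
  mem_entries.2 (Or.inr (Or.inr (Or.inl h)))

theorem mem_entries_high {x K m : ℕ} {e : Entry} (h : e ∈ highEntries m) : e ∈ entries x K m :=
  mem_entries.2 (Or.inl h)

theorem mem_entries_mid {x K m : ℕ} {e : Entry} (h : e ∈ midEntries m) : e ∈ entries x K m :=
  mem_entries.2 (Or.inr (Or.inl h))

theorem mem_entries_single {x K m : ℕ} {e : Entry} (h : e ∈ singleEntries m) :
    e ∈ entries x K m :=
  mem_entries.2 (Or.inr (Or.inr (Or.inr (Or.inl h))))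

theorem mem_entries_single' {x K m : ℕ} {e : Entry} (h : e ∈ singleEntries' x) :
    e ∈ entries x K m :=
  mem_entries.2 (Or.inr (Or.inr (Or.inr (Or.inr (Or.inl h)))))

theorem mem_entries_power {x K m y : ℕ} {e : Entry} (h2 : 2 ≤ y) (hy : y ≤ m + 4)
    (h : e ∈ powerEntries x y) : e ∈ entries x K m :=
  mem_entries.2 (Or.inr (Or.inr (Or.inr (Or.inr (Or.inr (Or.inl ⟨y, h2, hy, h⟩))))))

theorem mem_entries_last {x K m : ℕ} {e : Entry} (h : e ∈ lastEntries x K m) :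
    e ∈ entries x K m :=
  mem_entries.2 (Or.inr (Or.inr (Or.inr (Or.inr (Or.inr (Or.inr h))))))

theorem covered_a₁_zero {x K m : ℕ} (h : Admissible x K m) (l : List ℕ) {y : ℕ} (h1 : 1 ≤ y)
    (hy : y ≤ x) : Covered x K m false x (2 :: 3 :: l) y := by
  have hx : x = 1 ∨ x = 2 ∨ x = 3 := by rcases h with h | h | h | h <;> omega
  rcases hx with rfl | rfl | rfl
  · obtain rfl : y = 1 := by omega
    exact covered_self [1, 2, 2] (by simp [RunPrefix])
      (mem_entries_low (by simp [lowEntries]))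
  · obtain rfl | rfl : y = 1 ∨ y = 2 := by omega
    · exact covered_of_lt [1, 2, 1] (by norm_num) (by simp [RunPrefix])
        (mem_entries_low (by simp [lowEntries]))
    · exact covered_self [2, 2, 2] (by simp [RunPrefix])
        (mem_entries_low (by simp [lowEntries]))
  · obtain rfl | rfl | rfl : y = 1 ∨ y = 2 ∨ y = 3 := by omega
    · exact covered_of_lt [1, 2, 1] (by norm_num) (by simp [RunPrefix])
        (mem_entries_low (by simp [lowEntries]))
    · exact covered_of_lt [2, 2, 1] (by norm_num) (by simp [RunPrefix])
        (mem_entries_low (by simp [lowEntries]))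
    · exact covered_self [3, 2, 1] (by simp [RunPrefix])
        (mem_entries_mid (mem_midEntries.2 (Or.inl ⟨2, by norm_num, by norm_num, rfl⟩)))

/-- The b-run following a^d has length d + 2, so for `y ≥ 4` it reveals whether `y` is the whole
run: exactly y + 2 letters b if so, at least y + 3 if the run is cut. -/
theorem covered_a₁ {x K m d : ℕ} (l : List ℕ) (hd : d < m + 4) {y : ℕ}
    (h1 : 1 ≤ y) (hy : y ≤ d) : Covered x K m false d ((d + 2) :: 3 :: l) y := by
  rcases hy.lt_or_eq with hy | rfl
  · obtain rfl | rfl | rfl | h4 : y = 1 ∨ y = 2 ∨ y = 3 ∨ 4 ≤ y := by omega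
    · exact covered_of_lt [1, 4] hy (by simp [RunPrefix]; omega)
        (mem_entries_low (by simp [lowEntries]))
    · exact covered_of_lt [2, 5] hy (by simp [RunPrefix]; omega)
        (mem_entries_low (by simp [lowEntries]))
    · exact covered_of_lt [3, d + 2, 2] hy (by simp [RunPrefix])
        (mem_entries_mid (mem_midEntries.2 (Or.inr (Or.inl ⟨d + 2, by omega, by omega,
          Or.inl rfl⟩))))
    · exact covered_of_lt [y, y + 3] hy (by simp [RunPrefix]; omega)
        (mem_entries_high (mem_highEntries.2 (Or.inr ⟨y, h4, by omega, Or.inr rfl⟩)))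
  · obtain rfl | rfl | rfl | h4 : y = 1 ∨ y = 2 ∨ y = 3 ∨ 4 ≤ y := by omega
    · exact covered_self [1, 3, 2] (by simp [RunPrefix])
        (mem_entries_low (by simp [lowEntries]))
    · exact covered_self [2, 4, 2] (by simp [RunPrefix])
        (mem_entries_low (by simp [lowEntries]))
    · exact covered_self [3, 5, 1] (by simp [RunPrefix])
        (mem_entries_mid (mem_midEntries.2 (Or.inl ⟨5, by norm_num, by norm_num, rfl⟩)))
    · exact covered_self [y, y + 2, 1] (by simp [RunPrefix])
        (mem_entries_high (mem_highEntries.2 (Or.inr ⟨y, h4, by omega, Or.inl rfl⟩)))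

/-- After aaa the run b^(d+2) is repeated; at least y + 1 letters b there show that the first run is
cut. -/
theorem covered_b₁ {x K m d : ℕ} (h : Admissible x K m) (l : List ℕ) (hd : d < m + 4) {y : ℕ}
    (h1 : 1 ≤ y) (hy : y ≤ d + 2) :
    Covered x K m true (d + 2) (3 :: (d + 2) :: 1 :: 1 :: l) y := by
  have hx : x = 1 ∨ x = 2 ∨ x = 3 := by rcases h with h | h | h | h <;> omega
  rcases hy.lt_or_eq with hy | rfl
  · rcases h1.lt_or_eq with h2 | rfl
    · exact covered_of_lt [y, 3, y + 1] hy (by simp [RunPrefix]; omega)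
        (mem_entries_power h2 (by omega) (by simp [powerEntries]))
    · by_cases h5 : d = 3
      · subst h5
        exact covered_of_lt [1, 3, 5, 1, 1] hy (by simp [RunPrefix])
          (mem_entries_single (mem_singleEntries.2 (by simp)))
      · exact covered_of_lt [1, 3, d + 2, 1] hy (by simp [RunPrefix])
          (mem_entries_single (mem_singleEntries.2 (Or.inr (Or.inl
            ⟨d + 2, by omega, by omega, by omega, rfl⟩))))
  · rcases Nat.lt_or_ge d (m + 3) with hd' | hd'
    · rcases hx with rfl | rfl | rfl
      · exact covered_self [d + 2, 3, d + 2, 1] (by simp [RunPrefix])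
          (mem_entries_power (y := d + 2) (by omega) (by omega) (by simp [powerEntries]))
      · exact covered_self [d + 2, 3, d + 2, 1] (by simp [RunPrefix])
          (mem_entries_power (y := d + 2) (by omega) (by omega) (by simp [powerEntries]))
      · exact covered_self [d + 2, 3, d + 2, 1, 1] (by simp [RunPrefix])
          (mem_entries_power (y := d + 2) (by omega) (by omega) (by simp [powerEntries]))
    · obtain rfl : d = m + 3 := by omega
      rcases hx with rfl | rfl | rfl
      · exact covered_self [m + 5, 3] (by simp [RunPrefix])
          (mem_entries_last (by simp [lastEntries]))
      · exact covered_self [m + 5, 3] (by simp [RunPrefix])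
          (mem_entries_last (by simp [lastEntries]))
      · exact covered_self [m + 5, 3, m + 5] (by simp [RunPrefix])
          (mem_entries_last (by simp [lastEntries]))

theorem covered_a₂ {x K m d : ℕ} (h : Admissible x K m) (l : List ℕ) (hd : d < m + 4) {y : ℕ}
    (h1 : 1 ≤ y) (hy : y ≤ 3) : Covered x K m false 3 ((d + 2) :: 1 :: 1 :: l) y := by
  have hx : x = 1 ∨ x = 2 ∨ x = 3 := by rcases h with h | h | h | h <;> omega
  obtain rfl | rfl | rfl : y = 1 ∨ y = 2 ∨ y = 3 := by omega
  · obtain rfl | rfl | h4 : d = 0 ∨ d = 1 ∨ 2 ≤ d := by omega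
    · rcases hx with rfl | rfl | rfl
      · exact covered_of_lt [1, 2, 1, 1] (by norm_num) (by simp [RunPrefix])
          (mem_entries_low (by simp [lowEntries]))
      all_goals
        exact covered_of_lt [1, 2, 1] (by norm_num) (by simp [RunPrefix])
          (mem_entries_low (by simp [lowEntries]))
    · exact covered_of_lt [1, 3, 1, 1] (by norm_num) (by simp [RunPrefix])
        (mem_entries_low (by simp [lowEntries]))
    · exact covered_of_lt [1, 4] (by norm_num) (by simp [RunPrefix]; omega)
        (mem_entries_low (by simp [lowEntries]))
  · obtain rfl | rfl | rfl | h4 : d = 0 ∨ d = 1 ∨ d = 2 ∨ 3 ≤ d := by omega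
    · rcases hx with rfl | rfl | rfl
      · exact covered_of_lt [2, 2, 1] (by norm_num) (by simp [RunPrefix])
          (mem_entries_low (by simp [lowEntries]))
      · exact covered_of_lt [2, 2, 1, 1] (by norm_num) (by simp [RunPrefix])
          (mem_entries_low (by simp [lowEntries]))
      · exact covered_of_lt [2, 2, 1] (by norm_num) (by simp [RunPrefix])
          (mem_entries_low (by simp [lowEntries]))
    · exact covered_of_lt [2, 3, 1] (by norm_num) (by simp [RunPrefix])
        (mem_entries_low (by simp [lowEntries]))
    · exact covered_of_lt [2, 4, 1, 1] (by norm_num) (by simp [RunPrefix])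
        (mem_entries_low (by simp [lowEntries]))
    · exact covered_of_lt [2, 5] (by norm_num) (by simp [RunPrefix]; omega)
        (mem_entries_low (by simp [lowEntries]))
  · rcases Nat.lt_or_ge d 4 with hd' | hd'
    · exact covered_self [3, d + 2, 1] (by simp [RunPrefix])
        (mem_entries_mid (mem_midEntries.2 (Or.inl ⟨d + 2, by omega, by omega, rfl⟩)))
    · exact covered_self [3, d + 2, 1, 1] (by simp [RunPrefix])
        (mem_entries_mid (mem_midEntries.2 (Or.inr (Or.inl ⟨d + 2, by omega, by omega,
          Or.inr rfl⟩))))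

/-- After ab comes a^(d+1), and d + 1 ≥ y holds exactly when the run b^(d+2) is cut. -/
theorem covered_b₂ {x K m d q : ℕ} (h : Admissible x K m) (l : List ℕ) (hd : d < m + 4)
    (hq : 1 ≤ q) {y : ℕ} (h1 : 1 ≤ y) (hy : y ≤ d + 2) :
    Covered x K m true (d + 2) (1 :: 1 :: (d + 1) :: q :: l) y := by
  have hx : x = 1 ∨ x = 2 ∨ x = 3 := by rcases h with h | h | h | h <;> omega
  rcases hy.lt_or_eq with hy | rfl
  · rcases h1.lt_or_eq with h2 | rfl
    · exact covered_of_lt [y, 1, 1, y] hy (by simp [RunPrefix]; omega)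
        (mem_entries_power h2 (by omega) (by simp [powerEntries]))
    · exact covered_of_lt [1, 1, 1, 1] hy (by simp [RunPrefix])
        (mem_entries_single' (by simp [singleEntries']))
  · rcases Nat.lt_or_ge d (m + 3) with hd' | hd'
    · exact covered_self [d + 2, 1, 1, d + 1, 1] (by simp [RunPrefix]; omega)
        (mem_entries_power (y := d + 2) (by omega) (by omega) (by simp [powerEntries]))
    · obtain rfl : d = m + 3 := by omega
      rcases hx with rfl | rfl | rfl
      · exact covered_self [m + 5, 1, 1, 1] (by simp [RunPrefix])
          (mem_entries_last (by simp [lastEntries]))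
      all_goals
        exact covered_self [m + 5, 1, 1] (by simp [RunPrefix])
          (mem_entries_last (by simp [lastEntries]))

theorem covered_b₃ {x K m d q p' : ℕ} (h : Admissible x K m) (l : List ℕ)
    (hq : d < m + 3 ∧ q = d + 3 ∧ p' = 3 ∨ d = m + 3 ∧ q = K ∧ p' = x) :
    Covered x K m true 1 ((d + 1) :: q :: p' :: l) 1 := by
  have hx : x = 1 ∨ x = 2 ∨ x = 3 := by rcases h with h | h | h | h <;> omega
  obtain rfl | rfl | rfl | h4 : d = 0 ∨ d = 1 ∨ d = 2 ∨ 3 ≤ d := by omega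
  · rcases hx with rfl | rfl | rfl
    · exact covered_self [1, 1, 3] (by simp [RunPrefix]; omega)
        (mem_entries_single' (by simp [singleEntries']))
    all_goals
      exact covered_self [1, 1, 2] (by simp [RunPrefix]; omega)
        (mem_entries_single' (by simp [singleEntries']))
  · rcases hx with rfl | rfl | rfl
    · exact covered_self [1, 2, 1] (by simp [RunPrefix]; omega)
        (mem_entries_single' (by simp [singleEntries']))
    · exact covered_self [1, 2, 3] (by simp [RunPrefix]; omega)
        (mem_entries_single' (by simp [singleEntries']))
    · exact covered_self [1, 2, 1] (by simp [RunPrefix]; omega)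
        (mem_entries_single' (by simp [singleEntries']))
  · exact covered_self [1, 3, 5, 2] (by simp [RunPrefix]; omega)
      (mem_entries_single (mem_singleEntries.2 (by simp)))
  · exact covered_self [1, 4] (by simp [RunPrefix]; omega)
      (mem_entries_single (mem_singleEntries.2 (by simp)))

theorem covered_a₄ {x K m : ℕ} (hK : m + 6 ≤ K) (l : List ℕ) {y : ℕ} (h1 : 1 ≤ y)
    (hy : y ≤ m + 4) : Covered x K m false (m + 4) (K :: l) y := by
  rcases hy.lt_or_eq with hy | rfl
  · obtain rfl | rfl | rfl | h4 : y = 1 ∨ y = 2 ∨ y = 3 ∨ 4 ≤ y := by omega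
    · exact covered_of_lt [1, 4] hy (by simp [RunPrefix]; omega)
        (mem_entries_low (by simp [lowEntries]))
    · exact covered_of_lt [2, 5] hy (by simp [RunPrefix]; omega)
        (mem_entries_low (by simp [lowEntries]))
    · exact covered_of_lt [3, m + 6] hy (by simp [RunPrefix]; omega)
        (mem_entries_mid (mem_midEntries.2 (by simp)))
    · exact covered_of_lt [y, y + 3] hy (by simp [RunPrefix]; omega)
        (mem_entries_high (mem_highEntries.2 (Or.inr ⟨y, h4, by omega, Or.inr rfl⟩)))
  · exact covered_self [m + 4] (by simp [RunPrefix]) (mem_entries_high (mem_highEntries.2 (by simp)))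

/-- Suffixes of the long run b^K meet every group of conjugates with a fixed number of b's; `x`
decides where in the group they fall. -/
theorem covered_b₄ {x K m : ℕ} (h : Admissible x K m) (l : List ℕ) {y : ℕ} (h1 : 1 ≤ y)
    (hy : y ≤ K) : Covered x K m true K (x :: 2 :: 3 :: l) y := by
  have hx : x = 1 ∨ x = 2 ∨ x = 3 := by rcases h with h | h | h | h <;> omega
  have hK : K = m + 6 ∨ K = m + 7 ∧ x = 1 := by rcases h with h | h | h | h <;> omega
  obtain rfl | ⟨h2, hy'⟩ | rfl | h6 : y = 1 ∨ (2 ≤ y ∧ y ≤ m + 4) ∨ y = m + 5 ∨ m + 6 ≤ y := by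
    omega
  · rcases hx with rfl | rfl | rfl
    · exact covered_of_lt [1, 1, 2, 1] (by omega) (by simp [RunPrefix])
        (mem_entries_single' (by simp [singleEntries']))
    · exact covered_of_lt [1, 2, 2, 1] (by omega) (by simp [RunPrefix])
        (mem_entries_single' (by simp [singleEntries']))
    · exact covered_of_lt [1, 3, 2, 1] (by omega) (by simp [RunPrefix])
        (mem_entries_single (mem_singleEntries.2 (Or.inr (Or.inl
          ⟨2, by omega, by omega, by omega, rfl⟩))))
  · rcases hx with rfl | rfl | rfl
    · exact covered_of_lt [y, 1, 2] (by omega) (by simp [RunPrefix])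
        (mem_entries_power h2 hy' (by simp [powerEntries]))
    · exact covered_of_lt [y, 2, 1] (by omega) (by simp [RunPrefix])
        (mem_entries_power h2 hy' (by simp [powerEntries]))
    · exact covered_of_lt [y, 3, 2, 2] (by omega) (by simp [RunPrefix])
        (mem_entries_power h2 hy' (by simp [powerEntries]))
  · rcases hx with rfl | rfl | rfl
    · exact covered_of_lt [m + 5, 1, 2] (by omega) (by simp [RunPrefix])
        (mem_entries_last (by simp [lastEntries]))
    · exact covered_of_lt [m + 5, 2, 1] (by omega) (by simp [RunPrefix])
        (mem_entries_last (by simp [lastEntries]))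
    · exact covered_of_lt [m + 5, 3, 2, 2] (by omega) (by simp [RunPrefix])
        (mem_entries_last (by simp [lastEntries]))
  · rcases hK with rfl | ⟨rfl, rfl⟩
    · obtain rfl : y = m + 6 := by omega
      exact covered_self [m + 6] (by simp [RunPrefix]) (mem_entries_last (by simp [lastEntries]))
    · rcases hy.lt_or_eq with hy | rfl
      · obtain rfl : y = m + 6 := by omega
        exact covered_of_lt [m + 6, 1] hy (by simp [RunPrefix])
          (mem_entries_last (by simp [lastEntries]))
      · exact covered_self [m + 7] (by simp [RunPrefix]) (mem_entries_last (by simp [lastEntries]))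

theorem covered_of_isRun {x K m : ℕ} (h : Admissible x K m) {s : Bool} {n : ℕ} {l : List ℕ}
    (hrun : IsRun (cycleRuns x K m) s n l) {y : ℕ} (h1 : 1 ≤ y) (hy : y ≤ n) :
    Covered x K m s n l y := by
  have hK : m + 6 ≤ K := by rcases h with h | h | h | h <;> omega
  cases runShape_of_isRun hrun with
  | a₁ d _ q p' N hd hp =>
    rcases hp with ⟨rfl, rfl⟩ | ⟨hd1, rfl⟩
    · exact covered_a₁_zero h _ h1 hy
    · exact covered_a₁ _ hd h1 hy
  | b₁ d q p' N hd => exact covered_b₁ h _ hd h1 hy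
  | a₂ d q p' N hd => exact covered_a₂ h _ hd h1 hy
  | b₂ d q p' N hd hq => exact covered_b₂ h _ hd (by omega) h1 hy
  | a₃ d N hd =>
    obtain rfl : y = 1 := by omega
    exact covered_self [1, 1, 1] (by simp [RunPrefix]) (mem_entries_low (by simp [lowEntries]))
  | b₃ d q p' N hd hq =>
    obtain rfl : y = 1 := by omega
    exact covered_b₃ h _ hq
  | a₄ N => exact covered_a₄ hK _ h1 hy
  | b₄ N => exact covered_b₄ h _ h1 hy

/-! ### Every table entry occurs -/

/-- The prefix with first letter indexed by `s` and run lengths `p` occurs cyclically. -/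
def Occurs (x K m : ℕ) (s : Bool) (p : List ℕ) : Prop :=
  ∃ n l y, IsRun (cycleRuns x K m) s n l ∧ 1 ≤ y ∧ y ≤ n ∧ RunPrefix p (y :: l)

section

variable {x K m d y : ℕ} {p : List ℕ}

theorem occurs_a₁_zero (h1 : 1 ≤ y) (hy : y ≤ x) (h : ∀ l, RunPrefix p (y :: 2 :: 3 :: l)) :
    Occurs x K m false p := by
  obtain ⟨n, q, p', hn, -, ⟨N, hN⟩, -⟩ := exists_isRun_block x K m 0 (by omega)
  exact ⟨_, _, y, hN, h1, by omega, h _⟩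

theorem occurs_a₁ (hd1 : 1 ≤ d) (hd : d < m + 4) (h1 : 1 ≤ y) (hy : y ≤ d)
    (h : ∀ l, RunPrefix p (y :: (d + 2) :: 3 :: l)) : Occurs x K m false p := by
  obtain ⟨n, q, p', hn, -, ⟨N, hN⟩, -⟩ := exists_isRun_block x K m d hd
  exact ⟨_, _, y, hN, h1, by omega, h _⟩

theorem occurs_b₁ (hd : d < m + 4) (h1 : 1 ≤ y) (hy : y ≤ d + 2)
    (h : ∀ l, RunPrefix p (y :: 3 :: (d + 2) :: 1 :: 1 :: l)) : Occurs x K m true p := by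
  obtain ⟨n, q, p', -, -, -, ⟨N, hN⟩, -⟩ := exists_isRun_block x K m d hd
  exact ⟨_, _, y, hN, h1, hy, h _⟩

theorem occurs_a₂ (hd : d < m + 4) (h1 : 1 ≤ y) (hy : y ≤ 3)
    (h : ∀ l, RunPrefix p (y :: (d + 2) :: 1 :: 1 :: l)) : Occurs x K m false p := by
  obtain ⟨n, q, p', -, -, -, -, ⟨N, hN⟩, -⟩ := exists_isRun_block x K m d hd
  exact ⟨_, _, y, hN, h1, hy, h _⟩

theorem occurs_b₂ (hK : 1 ≤ K) (hd : d < m + 4) (h1 : 1 ≤ y) (hy : y ≤ d + 2)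
    (h : ∀ q l, 1 ≤ q → RunPrefix p (y :: 1 :: 1 :: (d + 1) :: q :: l)) :
    Occurs x K m true p := by
  obtain ⟨n, q, p', -, hq, -, -, -, ⟨N, hN⟩, -⟩ := exists_isRun_block x K m d hd
  exact ⟨_, _, y, hN, h1, hy, h _ _ (by omega)⟩

theorem occurs_a₃ (h : ∀ l, RunPrefix p (1 :: 1 :: 1 :: l)) : Occurs x K m false p := by
  obtain ⟨n, q, p', -, -, -, -, -, -, ⟨N, hN⟩, -⟩ := exists_isRun_block x K m 0 (by omega)
  exact ⟨_, _, 1, hN, le_rfl, le_rfl, h _⟩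

theorem occurs_b₃ (hd : d < m + 3)
    (h : ∀ l, RunPrefix p (1 :: (d + 1) :: (d + 3) :: 3 :: l)) : Occurs x K m true p := by
  obtain ⟨n, q, p', -, hq, -, -, -, -, -, ⟨N, hN⟩⟩ := exists_isRun_block x K m d (by omega)
  obtain ⟨-, rfl, rfl⟩ | h' := hq
  · exact ⟨_, _, 1, hN, le_rfl, le_rfl, h _⟩
  · omega

theorem occurs_a₄ (h1 : 1 ≤ y) (hy : y ≤ m + 4) (h : ∀ l, RunPrefix p (y :: K :: l)) :
    Occurs x K m false p := by
  obtain ⟨⟨N, hN⟩, -⟩ := exists_isRun_last x K m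
  exact ⟨_, _, y, hN, h1, hy, h _⟩

theorem occurs_b₄ (h1 : 1 ≤ y) (hy : y ≤ K) (h : ∀ l, RunPrefix p (y :: x :: 2 :: 3 :: l)) :
    Occurs x K m true p := by
  obtain ⟨-, ⟨N, hN⟩⟩ := exists_isRun_last x K m
  exact ⟨_, _, y, hN, h1, hy, h _⟩

end

theorem occurs_of_mem_highEntries {x K m : ℕ} (hK : m + 6 ≤ K) {e : Entry}
    (he : e ∈ highEntries m) : Occurs x K m e.fst e.lens := by
  rcases mem_highEntries.1 he with rfl | ⟨y, h4, hy, rfl | rfl⟩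
  · exact occurs_a₄ (y := m + 4) (by omega) le_rfl fun l => by simp [RunPrefix]
  · exact occurs_a₁ (d := y) (y := y) (by omega) (by omega) (by omega) le_rfl fun l => by
      simp [RunPrefix]
  · rcases hy.lt_or_eq with hy | rfl
    · exact occurs_a₁ (d := y + 1) (y := y) (by omega) (by omega) (by omega) (by omega) fun l => by
        simp [RunPrefix]
    -- The only a-run longer than m + 3 is the closing one of length m + 4, followed by `K ≥ m + 6`
    -- letters b.
    · exact occurs_a₄ (y := m + 3) (by omega) (by omega) fun l => by simp [RunPrefix]; omega

theorem occurs_of_mem_midEntries {x K m : ℕ} (hK : m + 6 ≤ K) {e : Entry}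
    (he : e ∈ midEntries m) : Occurs x K m e.fst e.lens := by
  rcases mem_midEntries.1 he with ⟨q, h2, h5, rfl⟩ | ⟨q, h6, hq, rfl | rfl⟩ | rfl
  · exact occurs_a₂ (d := q - 2) (y := 3) (by omega) (by omega) le_rfl fun l => by
      simp [RunPrefix]; omega
  · exact occurs_a₁ (d := q - 2) (y := 3) (by omega) (by omega) (by omega) (by omega) fun l => by
      simp [RunPrefix]; omega
  · exact occurs_a₂ (d := q - 2) (y := 3) (by omega) (by omega) le_rfl fun l => by
      simp [RunPrefix]; omega
  · exact occurs_a₄ (y := 3) (by omega) (by omega) fun l => by simp [RunPrefix]; omega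

theorem occurs_of_mem_lowEntries {x K m : ℕ} (hx : x = 1 ∨ x = 2 ∨ x = 3) {e : Entry}
    (he : e ∈ lowEntries x) : Occurs x K m e.fst e.lens := by
  have h0 : e ∈ [(⟨false, [2, 3, 1], false⟩ : Entry), ⟨false, [2, 4, 2], true⟩,
      ⟨false, [2, 4, 1, 1], false⟩, ⟨false, [2, 5], false⟩, ⟨false, [1, 1, 1], true⟩,
      ⟨false, [1, 3, 2], true⟩, ⟨false, [1, 3, 1, 1], false⟩, ⟨false, [1, 4], false⟩] →
      Occurs x K m e.fst e.lens := by
    simp only [List.mem_cons, List.not_mem_nil, or_false]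
    rintro (rfl | rfl | rfl | rfl | rfl | rfl | rfl | rfl)
    · exact occurs_a₂ (d := 1) (y := 2) (by omega) (by omega) (by omega) fun l => by
        simp [RunPrefix]
    · exact occurs_a₁ (d := 2) (y := 2) (by omega) (by omega) (by omega) (by omega) fun l => by
        simp [RunPrefix]
    · exact occurs_a₂ (d := 2) (y := 2) (by omega) (by omega) (by omega) fun l => by
        simp [RunPrefix]
    · exact occurs_a₂ (d := 3) (y := 2) (by omega) (by omega) (by omega) fun l => by
        simp [RunPrefix]
    · exact occurs_a₃ fun l => by simp [RunPrefix]
    · exact occurs_a₁ (d := 1) (y := 1) (by omega) (by omega) (by omega) (by omega) fun l => by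
        simp [RunPrefix]
    · exact occurs_a₂ (d := 1) (y := 1) (by omega) (by omega) (by omega) fun l => by
        simp [RunPrefix]
    · exact occurs_a₂ (d := 2) (y := 1) (by omega) (by omega) (by omega) fun l => by
        simp [RunPrefix]
  have h1 : e ∈ [(⟨false, [2, 2, 1], false⟩ : Entry), ⟨false, [2, 2, 1, 1], false⟩,
      ⟨false, [1, 2, 1], false⟩, ⟨false, [1, 2, 1, 1], false⟩] → Occurs x K m e.fst e.lens := by
    simp only [List.mem_cons, List.not_mem_nil, or_false]
    rintro (rfl | rfl | rfl | rfl)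
    · exact occurs_a₂ (d := 0) (y := 2) (by omega) (by omega) (by omega) fun l => by
        simp [RunPrefix]
    · exact occurs_a₂ (d := 0) (y := 2) (by omega) (by omega) (by omega) fun l => by
        simp [RunPrefix]
    · exact occurs_a₂ (d := 0) (y := 1) (by omega) (by omega) (by omega) fun l => by
        simp [RunPrefix]
    · exact occurs_a₂ (d := 0) (y := 1) (by omega) (by omega) (by omega) fun l => by
        simp [RunPrefix]
  have h2 : 2 ≤ x → e = ⟨false, [2, 2, 2], true⟩ → Occurs x K m e.fst e.lens := by
    rintro hx rfl
    exact occurs_a₁_zero (y := 2) (by omega) hx fun l => by simp [RunPrefix]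
  have h3 : e = ⟨false, [1, 2, 2], true⟩ → Occurs x K m e.fst e.lens := by
    rintro rfl
    exact occurs_a₁_zero (y := 1) (by omega) (by omega) fun l => by simp [RunPrefix]
  simp only [List.mem_cons, List.not_mem_nil, or_false] at h0 h1
  rcases hx with rfl | rfl | rfl <;> simp [lowEntries] at he <;> tauto

theorem occurs_of_mem_singleEntries {x K m : ℕ} {e : Entry}
    (he : e ∈ singleEntries m) : Occurs x K m e.fst e.lens := by
  rcases mem_singleEntries.1 he with rfl | ⟨q, h2, hq, -, rfl⟩ | rfl | rfl
  -- Block 3 is the last one when `m = 0`, where `occurs_b₃` does not apply; the prefix `[1, 4]`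
  -- does not involve the runs that differ there.
  · obtain ⟨n, q, p', -, -, -, -, -, -, -, ⟨N, hN⟩⟩ := exists_isRun_block x K m 3 (by omega)
    exact ⟨_, _, 1, hN, le_rfl, le_rfl, by simp [RunPrefix]⟩
  · exact occurs_b₁ (d := q - 2) (y := 1) (by omega) (by omega) (by omega) fun l => by
      simp [RunPrefix]; omega
  · exact occurs_b₃ (d := 2) (by omega) fun l => by simp [RunPrefix]
  · exact occurs_b₁ (d := 3) (y := 1) (by omega) (by omega) (by omega) fun l => by
      simp [RunPrefix]

theorem occurs_of_mem_singleEntries' {x K m : ℕ} (hx : x = 1 ∨ x = 2 ∨ x = 3) (hK : m + 6 ≤ K)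
    {e : Entry} (he : e ∈ singleEntries' x) : Occurs x K m e.fst e.lens := by
  have h0 : e ∈ [(⟨true, [1, 1, 1, 1], true⟩ : Entry), ⟨true, [1, 2, 3], false⟩,
      ⟨true, [1, 2, 1], false⟩, ⟨true, [1, 1, 3], false⟩, ⟨true, [1, 1, 2], false⟩] →
      Occurs x K m e.fst e.lens := by
    simp only [List.mem_cons, List.not_mem_nil, or_false]
    rintro (rfl | rfl | rfl | rfl | rfl)
    · exact occurs_b₂ (d := 0) (y := 1) (by omega) (by omega) (by omega) (by omega)
        fun q l _ => by simp [RunPrefix]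
    · exact occurs_b₃ (d := 1) (by omega) fun l => by simp [RunPrefix]
    · exact occurs_b₃ (d := 1) (by omega) fun l => by simp [RunPrefix]
    · exact occurs_b₃ (d := 0) (by omega) fun l => by simp [RunPrefix]
    · exact occurs_b₃ (d := 0) (by omega) fun l => by simp [RunPrefix]
  have h1 : e = ⟨true, [1, x, 2, 1], true⟩ → Occurs x K m e.fst e.lens := by
    rintro rfl
    exact occurs_b₄ (y := 1) (by omega) (by omega) fun l => by simp [RunPrefix]
  simp only [List.mem_cons, List.not_mem_nil, or_false] at h0
  rcases hx with rfl | rfl | rfl <;> simp [singleEntries'] at he <;> tauto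

theorem occurs_of_mem_powerEntries {x K m y : ℕ} (hx : x = 1 ∨ x = 2 ∨ x = 3) (hK : m + 6 ≤ K)
    (h2 : 2 ≤ y) (hy : y ≤ m + 4) {e : Entry} (he : e ∈ powerEntries x y) :
    Occurs x K m e.fst e.lens := by
  have h0 : e ∈ [(⟨true, [y, 3, y, 1, 1], false⟩ : Entry), ⟨true, [y, 3, y, 1], false⟩,
      ⟨true, [y, 3, y + 1], true⟩, ⟨true, [y, 1, 1, y], true⟩,
      ⟨true, [y, 1, 1, y - 1, 1], false⟩] → Occurs x K m e.fst e.lens := by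
    simp only [List.mem_cons, List.not_mem_nil, or_false]
    rintro (rfl | rfl | rfl | rfl | rfl)
    · exact occurs_b₁ (d := y - 2) (y := y) (by omega) (by omega) (by omega) fun l => by
        simp [RunPrefix]; omega
    · exact occurs_b₁ (d := y - 2) (y := y) (by omega) (by omega) (by omega) fun l => by
        simp [RunPrefix]; omega
    · exact occurs_b₁ (d := y - 1) (y := y) (by omega) (by omega) (by omega) fun l => by
        simp [RunPrefix]; omega
    · exact occurs_b₂ (d := y - 1) (y := y) (by omega) (by omega) (by omega) (by omega)
        fun q l _ => by simp [RunPrefix]; omega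
    · exact occurs_b₂ (d := y - 2) (y := y) (by omega) (by omega) (by omega) (by omega)
        fun q l _ => by simp [RunPrefix]; omega
  have h1 : (x = 3 ∧ e = ⟨true, [y, 3, 2, 2], true⟩ ∨ x = 2 ∧ e = ⟨true, [y, 2, 1], true⟩ ∨
      x = 1 ∧ e = ⟨true, [y, 1, 2], true⟩) → Occurs x K m e.fst e.lens := by
    rintro (⟨rfl, rfl⟩ | ⟨rfl, rfl⟩ | ⟨rfl, rfl⟩) <;>
    exact occurs_b₄ (y := y) (by omega) (by omega) fun l => by simp [RunPrefix]
  simp only [List.mem_cons, List.not_mem_nil, or_false] at h0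
  rcases hx with rfl | rfl | rfl <;> simp [powerEntries] at he h1 <;> tauto

theorem occurs_of_mem_lastEntries {x K m : ℕ} (h : Admissible x K m) {e : Entry}
    (he : e ∈ lastEntries x K m) : Occurs x K m e.fst e.lens := by
  have hK : m + 6 ≤ K := by rcases h with h | h | h | h <;> omega
  have h0 : e ∈ [(⟨true, [m + 5, 3], false⟩ : Entry), ⟨true, [m + 5, 3, m + 5], false⟩,
      ⟨true, [m + 5, 1, 1], false⟩, ⟨true, [m + 5, 1, 1, 1], false⟩, ⟨true, [m + 6], false⟩] →
      Occurs x K m e.fst e.lens := by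
    simp only [List.mem_cons, List.not_mem_nil, or_false]
    rintro (rfl | rfl | rfl | rfl | rfl)
    · exact occurs_b₁ (d := m + 3) (y := m + 5) (by omega) (by omega) (by omega) fun l => by
        simp [RunPrefix]
    · exact occurs_b₁ (d := m + 3) (y := m + 5) (by omega) (by omega) (by omega) fun l => by
        simp [RunPrefix]
    · exact occurs_b₂ (d := m + 3) (y := m + 5) (by omega) (by omega) (by omega) (by omega)
        fun q l _ => by simp [RunPrefix]
    · exact occurs_b₂ (d := m + 3) (y := m + 5) (by omega) (by omega) (by omega) (by omega)
        fun q l _ => by simp [RunPrefix]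
    · exact occurs_b₄ (y := m + 6) (by omega) (by omega) fun l => by simp [RunPrefix]
  have h1 : (x = 3 ∧ e = ⟨true, [m + 5, 3, 2, 2], true⟩ ∨
      x = 2 ∧ e = ⟨true, [m + 5, 2, 1], true⟩ ∨ x = 1 ∧ e = ⟨true, [m + 5, 1, 2], true⟩) →
      Occurs x K m e.fst e.lens := by
    rintro (⟨rfl, rfl⟩ | ⟨rfl, rfl⟩ | ⟨rfl, rfl⟩) <;>
    exact occurs_b₄ (y := m + 5) (by omega) (by omega) fun l => by simp [RunPrefix]
  have h2 : K = m + 7 ∧ x = 1 → e = ⟨true, [m + 6, 1], true⟩ ∨ e = ⟨true, [m + 7], false⟩ →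
      Occurs x K m e.fst e.lens := by
    rintro ⟨rfl, rfl⟩ (rfl | rfl)
    · exact occurs_b₄ (y := m + 6) (by omega) (by omega) fun l => by simp [RunPrefix]
    · exact occurs_b₄ (y := m + 7) (by omega) (by omega) fun l => by simp [RunPrefix]
  simp only [List.mem_cons, List.not_mem_nil, or_false] at h0
  rcases h with ⟨rfl, rfl⟩ | ⟨rfl, rfl⟩ | ⟨rfl, rfl⟩ | ⟨rfl, rfl⟩ <;>
    simp [lastEntries] at he h1 h2 <;> tauto

theorem occurs_of_mem_entries {x K m : ℕ} (h : Admissible x K m) {e : Entry}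
    (he : e ∈ entries x K m) : Occurs x K m e.fst e.lens := by
  have hx : x = 1 ∨ x = 2 ∨ x = 3 := by rcases h with h | h | h | h <;> omega
  have hK : m + 6 ≤ K := by rcases h with h | h | h | h <;> omega
  rcases mem_entries.1 he with he | he | he | he | he | ⟨y, h2, hy, he⟩ | he
  · exact occurs_of_mem_highEntries hK he
  · exact occurs_of_mem_midEntries hK he
  · exact occurs_of_mem_lowEntries hx he
  · exact occurs_of_mem_singleEntries he
  · exact occurs_of_mem_singleEntries' hx hK he
  · exact occurs_of_mem_powerEntries hx hK h2 hy he
  · exact occurs_of_mem_lastEntries h he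

/-- The number of runs of the Burrows-Wheeler transform of the word with run lengths
`cycleRuns x K m`. -/
theorem r_of_isRotated_decode_cycleRuns {α : Type*} [LinearOrder α] {a b : α} (hab : a < b)
    {x K m : ℕ} (h : Admissible x K m) {w : List α}
    (hw : w ~r decode a b false (cycleRuns x K m)) :
    r w = if x = 2 then 6 * m + 24 else 8 * m + 28 := by
  have hx : 0 < x := by rcases h with h | h | h | h <;> omega
  have hK : 0 < K := by rcases h with h | h | h | h <;> omega
  rw [← changes_entries h]
  exact r_eq_changes_entries hab hw (even_length_cycleRuns x K m)
    (fun n hn => pos_of_mem_cycleRuns hx hK hn) _ (isChain_entries h)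
    (fun s n l hrun y h1 hy => covered_of_isRun h hrun h1 hy)
    (fun e he => occurs_of_mem_entries h he)

/-! ### Identification of the four words -/

/-- The word `w_k` without its last letter. -/
def coreWord {α : Type*} (a b : α) (k : ℕ) : List α :=
  (List.range' 2 (k - 2)).flatMap (fun i => sWord a b i ++ eWord a b i) ++
    a :: List.replicate k b

theorem wWord_eq {α : Type*} (a b : α) (k : ℕ) : wWord a b k = coreWord a b k ++ [a] := by
  simp [wWord, coreWord, qWord]

/-- The leading run of block `i` consists of the i - 3 final letters of e_(i-1) and the first letter
of s_i. Splitting off these i - 3 letters makes the induction on the number of blocks close. -/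
theorem decode_flatMap_blockRuns {α : Type*} (a b : α) (x K n : ℕ) : ∀ i, 3 ≤ i →
    decode a b false ((List.range' i n).flatMap (blockRuns x) ++ [i + n - 2, K]) =
      List.replicate (i - 3) a ++
        ((List.range' i n).flatMap (fun i => sWord a b i ++ eWord a b i) ++
          a :: List.replicate K b) := by
  induction n with
  | zero =>
    intro i hi
    obtain ⟨j, rfl⟩ := Nat.exists_eq_add_of_le' hi
    simp [decode, letter, List.replicate_succ']
  | succ n ih =>
    intro i hi
    have h := ih (i + 1) (by omega)
    obtain ⟨j, rfl⟩ := Nat.exists_eq_add_of_le' hi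
    rw [show j + 3 + 1 + n = j + 3 + (n + 1) by ring] at h
    rw [List.range'_succ, List.flatMap_cons, List.flatMap_cons, blockRuns, if_neg (by omega),
      List.append_assoc, decode_append_of_even _ _ _ ⟨3, rfl⟩, h]
    simp [decode, letter, sWord, eWord, List.replicate_succ']

/-- The junction run is the first letter of s_2 together with `x` trailing a's, here rotated to the
front. -/
theorem decode_cycleRuns {α : Type*} (a b : α) (x K m : ℕ) :
    decode a b false (cycleRuns (x + 1) K m) = List.replicate x a ++
      ((List.range' 2 (m + 4)).flatMap (fun i => sWord a b i ++ eWord a b i) ++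
          a :: List.replicate K b) := by
  have h := decode_flatMap_blockRuns a b (x + 1) K (m + 3) 3 le_rfl
  rw [show 3 + (m + 3) - 2 = m + 4 by omega] at h
  rw [cycleRuns, List.range'_succ, List.flatMap_cons, List.flatMap_cons, blockRuns, if_pos rfl,
    List.append_assoc, decode_append_of_even _ _ _ ⟨3, rfl⟩, h]
  simp [decode, letter, sWord, eWord, List.replicate_succ']

theorem r_wWord {α : Type*} [LinearOrder α] {a b : α} (hab : a < b) (m : ℕ) :
    r (wWord a b (m + 6)) = 6 * m + 24 := by
  have h := decode_cycleRuns a b 1 (m + 6) m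
  rw [r_of_isRotated_decode_cycleRuns hab (x := 2) (K := m + 6) (m := m) (Or.inl ⟨rfl, rfl⟩)]
  · rfl
  · rw [h, wWord_eq]
    exact List.isRotated_append

theorem r_wWord_insertion {α : Type*} [LinearOrder α] {a b : α} (hab : a < b) (m : ℕ) :
    r (wWord a b (m + 6) ++ [a]) = 8 * m + 28 := by
  have h := decode_cycleRuns a b 2 (m + 6) m
  rw [r_of_isRotated_decode_cycleRuns hab (x := 3) (K := m + 6) (m := m)
    (Or.inr (Or.inl ⟨rfl, rfl⟩))]
  · rfl
  · rw [h, wWord_eq, List.append_assoc]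
    exact List.isRotated_append

theorem r_wWord_deletion {α : Type*} [LinearOrder α] {a b : α} (hab : a < b) (m : ℕ) :
    r (wWord a b (m + 6)).dropLast = 8 * m + 28 := by
  have h := decode_cycleRuns a b 0 (m + 6) m
  rw [r_of_isRotated_decode_cycleRuns hab (x := 1) (K := m + 6) (m := m)
    (Or.inr (Or.inr (Or.inl ⟨rfl, rfl⟩)))]
  · rfl
  · rw [h, wWord_eq, List.dropLast_concat]
    exact List.IsRotated.refl _

theorem r_wWord_substitution {α : Type*} [LinearOrder α] {a b : α} (hab : a < b) (m : ℕ) :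
    r ((wWord a b (m + 6)).dropLast ++ [b]) = 8 * m + 28 := by
  have h := decode_cycleRuns a b 0 (m + 7) m
  rw [r_of_isRotated_decode_cycleRuns hab (x := 1) (K := m + 7) (m := m)
    (Or.inr (Or.inr (Or.inr ⟨rfl, rfl⟩)))]
  · rfl
  · rw [h, wWord_eq, List.dropLast_concat, coreWord, List.append_assoc, List.cons_append,
      ← List.replicate_succ']
    exact List.IsRotated.refl _

/-! ### Lengths and asymptotics -/

theorem two_mul_length_wWord {α : Type*} (a b : α) (n : ℕ) :
    2 * (wWord a b (n + 2)).length = 3 * n ^ 2 + 19 * n + 8 := by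
  induction n with
  | zero => simp [wWord, qWord]
  | succ n ih =>
    -- The new factor s_i e_i with i = n + 2 has length 3i + 4, and the closing b-run grows by one.
    have h : (wWord a b (n + 1 + 2)).length =
        (wWord a b (n + 2)).length + (3 * (n + 2) + 5) := by
      rw [wWord, wWord, show n + 1 + 2 - 2 = n + 1 by omega, List.range'_concat]
      simp [sWord, eWord, qWord]
      ring
    rw [h, mul_add, ih]
    ring

theorem strictMonoOn_length_wWord {α : Type*} (a b : α) :
    StrictMonoOn (fun k : ℕ => (wWord a b k).length) (Set.Ioi 5) := by
  intro k hk l hl hkl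
  simp only [Set.mem_Ioi] at hk hl
  obtain ⟨i, rfl⟩ := Nat.exists_eq_add_of_le' (show 2 ≤ k by omega)
  obtain ⟨j, rfl⟩ := Nat.exists_eq_add_of_le' (show 2 ≤ l by omega)
  have hi := two_mul_length_wWord a b i
  have hj := two_mul_length_wWord a b j
  have : i < j := by omega
  have h2 : i ^ 2 ≤ j ^ 2 := Nat.pow_le_pow_left this.le 2
  show (wWord a b (i + 2)).length < (wWord a b (j + 2)).length
  omega

theorem isTheta_sqrt_length_wWord {α : Type*} (a b : α) :
    (fun k : ℕ => (2 * (k : ℝ) - 8)) =Θ[atTop]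
      (fun k : ℕ => Real.sqrt ((wWord a b k).length : ℝ)) := by
  have hlen : ∀ k : ℕ, 6 ≤ k →
      2 * ((wWord a b k).length : ℝ) = 3 * (k : ℝ) ^ 2 + 7 * k - 18 := by
    intro k hk
    obtain ⟨n, rfl⟩ := Nat.exists_eq_add_of_le' (show 2 ≤ k by omega)
    have h : (2 * (wWord a b (n + 2)).length : ℝ) = 3 * (n : ℝ) ^ 2 + 19 * n + 8 := by
      exact_mod_cast two_mul_length_wWord a b n
    rw [h]
    push_cast
    ring
  constructor
  · refine IsBigO.of_bound 2 ?_
    filter_upwards [eventually_ge_atTop 6] with k hk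
    have hk' : (6 : ℝ) ≤ k := by exact_mod_cast hk
    rw [Real.norm_of_nonneg (by linarith), Real.norm_of_nonneg (Real.sqrt_nonneg _)]
    have : (k : ℝ) - 4 ≤ Real.sqrt ((wWord a b k).length : ℝ) :=
      Real.le_sqrt_of_sq_le (by nlinarith [hlen k hk])
    linarith
  -- At k = 6 the length is 66 and 2k - 8 = 4; since √66 > 8, the constant 2 would fail there.
  · refine IsBigO.of_bound 3 ?_
    filter_upwards [eventually_ge_atTop 6] with k hk
    have hk' : (6 : ℝ) ≤ k := by exact_mod_cast hk
    rw [Real.norm_of_nonneg (show (0 : ℝ) ≤ 2 * k - 8 by linarith),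
      Real.norm_of_nonneg (Real.sqrt_nonneg _)]
    exact Real.sqrt_le_iff.2 ⟨by linarith, by nlinarith [hlen k hk]⟩

end BWT

theorem mainTheorem1 {α : Type*} [LinearOrder α] (a b : α) (hab : a < b) :
    -- each of the three words is obtained from `w_k` by the respective single edit,
    -- and each edit increases `r` by exactly `2k - 8`
    (∀ k : ℕ, 5 < k →
      (BWT.IsInsertion (BWT.wWord a b k) (BWT.wWord a b k ++ [a]) ∧
        BWT.r (BWT.wWord a b k ++ [a]) = BWT.r (BWT.wWord a b k) + (2 * k - 8)) ∧
      (BWT.IsDeletion (BWT.wWord a b k) (BWT.wWord a b k).dropLast ∧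
        BWT.r (BWT.wWord a b k).dropLast = BWT.r (BWT.wWord a b k) + (2 * k - 8)) ∧
      (BWT.IsSubstitution (BWT.wWord a b k) ((BWT.wWord a b k).dropLast ++ [b]) ∧
        BWT.r ((BWT.wWord a b k).dropLast ++ [b]) = BWT.r (BWT.wWord a b k) + (2 * k - 8))) ∧
    -- the family is infinite, with strictly increasing lengths
    StrictMonoOn (fun k : ℕ => (BWT.wWord a b k).length) (Set.Ioi 5) ∧
    -- in terms of the length `n = |w_k|`, the increases are `Θ(√n)`
    (fun k : ℕ => (2 * (k : ℝ) - 8)) =Θ[atTop]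
      (fun k : ℕ => Real.sqrt ((BWT.wWord a b k).length : ℝ)) ∧
    (fun k : ℕ => (BWT.r (BWT.wWord a b k ++ [a]) : ℝ) - (BWT.r (BWT.wWord a b k) : ℝ))
      =Θ[atTop] (fun k : ℕ => Real.sqrt ((BWT.wWord a b k).length : ℝ)) ∧
    (fun k : ℕ => (BWT.r (BWT.wWord a b k).dropLast : ℝ) - (BWT.r (BWT.wWord a b k) : ℝ))
      =Θ[atTop] (fun k : ℕ => Real.sqrt ((BWT.wWord a b k).length : ℝ)) ∧
    (fun k : ℕ =>
        (BWT.r ((BWT.wWord a b k).dropLast ++ [b]) : ℝ) - (BWT.r (BWT.wWord a b k) : ℝ))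
      =Θ[atTop] (fun k : ℕ => Real.sqrt ((BWT.wWord a b k).length : ℝ)) := by
  have hw : ∀ k : ℕ, 5 < k → BWT.r (BWT.wWord a b k) = 6 * k - 12 := by
    intro k hk
    obtain ⟨m, rfl⟩ := Nat.exists_eq_add_of_le' (show 6 ≤ k from hk)
    rw [BWT.r_wWord hab]
    omega
  have hins : ∀ k : ℕ, 5 < k →
      BWT.r (BWT.wWord a b k ++ [a]) = BWT.r (BWT.wWord a b k) + (2 * k - 8) := by
    intro k hk
    rw [hw k hk]
    obtain ⟨m, rfl⟩ := Nat.exists_eq_add_of_le' (show 6 ≤ k from hk)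
    rw [BWT.r_wWord_insertion hab]
    omega
  have hdel : ∀ k : ℕ, 5 < k →
      BWT.r (BWT.wWord a b k).dropLast = BWT.r (BWT.wWord a b k) + (2 * k - 8) := by
    intro k hk
    rw [hw k hk]
    obtain ⟨m, rfl⟩ := Nat.exists_eq_add_of_le' (show 6 ≤ k from hk)
    rw [BWT.r_wWord_deletion hab]
    omega
  have hsub : ∀ k : ℕ, 5 < k →
      BWT.r ((BWT.wWord a b k).dropLast ++ [b]) = BWT.r (BWT.wWord a b k) + (2 * k - 8) := by
    intro k hk
    rw [hw k hk]
    obtain ⟨m, rfl⟩ := Nat.exists_eq_add_of_le' (show 6 ≤ k from hk)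
    rw [BWT.r_wWord_substitution hab]
    omega
  have htheta := BWT.isTheta_sqrt_length_wWord a b
  -- The three edits share one increase, so a single transfer from `htheta` serves all; k > 5 makes
  -- the natural subtraction 2k - 8 genuine.
  have hdiff : ∀ f : ℕ → ℕ, (∀ k : ℕ, 5 < k → f k = BWT.r (BWT.wWord a b k) + (2 * k - 8)) →
      (fun k : ℕ => (f k : ℝ) - (BWT.r (BWT.wWord a b k) : ℝ)) =Θ[atTop]
        (fun k : ℕ => Real.sqrt ((BWT.wWord a b k).length : ℝ)) := by
    intro f hf
    refine (EventuallyEq.isTheta ?_).trans htheta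
    filter_upwards [eventually_gt_atTop 5] with k hk
    rw [hf k hk, Nat.cast_add, Nat.cast_sub (by omega)]
    push_cast
    ring
  refine ⟨fun k hk => ⟨⟨?_, hins k hk⟩, ⟨?_, hdel k hk⟩, ⟨?_, hsub k hk⟩⟩,
    BWT.strictMonoOn_length_wWord a b, htheta, hdiff _ hins, hdiff _ hdel, hdiff _ hsub⟩
  · exact ⟨BWT.wWord a b k, [], a, by simp, by simp⟩
  · exact ⟨BWT.coreWord a b k, [], a, by simp [BWT.wWord_eq], by simp [BWT.wWord_eq]⟩
  · exact ⟨BWT.coreWord a b k, [], a, b, hab.ne, by simp [BWT.wWord_eq],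
      by simp [BWT.wWord_eq]⟩
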